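/- All groups are profinite, homomorphisms are continuous, and $\twoheadrightarrow$ denotes an epimorphism. An epimorphism $\varphi\colon H\twoheadrightarrow G$ (a \emph{cover} of $G$) is \emph{indecomposable} if it is not an isomorphism and, whenever $\varphi=\rho\circ\psi$ with epimorphisms $\psi\colon H\twoheadrightarrow E$ and $\rho\colon E\twoheadrightarrow G$, one of $\psi,\rho$ is an isomorphism. Covers $\eta,\zeta$ of $G$ are isomorphic, $\eta\cong_G\zeta$, if there is an isomorphism $e$ of their domains with $\zeta\circ e=\eta$. A commutative square of epimorphisms $\eta'\circ\theta=\pi\circ\eta$ (with $\eta\colon H\twoheadrightarrow G$, $\eta'\colon H'\twoheadrightarrow G'$, $\theta\colon H\twoheadrightarrow H'$, $\pi\colon G\twoheadrightarrow G'$) is \emph{semi-cartesian} if $\theta(\operatorname{Ker}\eta)=\operatorname{Ker}\eta'$. The fiber product $\eta_I\colon\prod_{G,\,i\in I}H_i\twoheadrightarrow G$ of a family of covers $(\eta_i\colon H_i\twoheadrightarrow G)_{i\in I}$ is the group of all $(h_i)_{i\in I}$ whose images $\eta_i(h_i)$ agree, with $\eta_I$ the common image; for $I=\emptyset$ it is $\mathrm{id}_G$.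 Let $(\eta_i\colon H_i\twoheadrightarrow G)_{i\in I}$ be a family of indecomposable covers of $G$. For a cover $\zeta$ of $G$ put $I_\zeta=\{i\in I:\eta_i\cong_G\zeta\}$. For a finite simple $G$-module $A$ let $F_A=\operatorname{End}_G(A)$ (a finite field), let $I_A$ be the set of $i\in I$ such that $\operatorname{Ker}\eta_i$ is abelian and, with the $G$-action induced by conjugation in $H_i$, isomorphic to $A$, and let $B_A$ be the kernel of the fiber product $H_A=\prod_{G,\,i\in I_A}H_i\twoheadrightarrow G$; it is a profinite $G$-module. Let $f_A\in H^2(G,B_A)$ be the (continuous) cohomology class of the extension $0\to B_A\to H_A\to G\to 1$, let $V_A$ be the $F_A$-vector space of continuous $G$-homomorphisms $B_A\to A$, and let $S_A\colon V_A\to H^2(G,A)$ be the $F_A$-linear map $\varphi\mapsto\varphi_*(f_A)$. Let $\pi\colon G\twoheadrightarrow G'$ be an epimorphism, let $(\eta'_i\colon H'_i\twoheadrightarrow G')_{i\in I'}$ be a family of indecomposable covers of $G'$, and define $I'_{\zeta'}$, $V'_{A'}$ and $S'_{A'}\colon V'_{A'}\to H^2(G',A')$ for covers $\zeta'$ of $G'$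 and finite simple $G'$-modules $A'$ in the same way. For a finite simple $G'$-module $A'$ let $\operatorname{Inf}_\pi(A')$ be the group $A'$ with $G$ acting via $\pi$, and let $\operatorname{Inf}_{\pi,A'}\colon H^2(G',A')\to H^2(G,\operatorname{Inf}_\pi(A'))$ be the inflation map. For a cover $\zeta'\colon E'\twoheadrightarrow G'$ let $\operatorname{Inf}_\pi(\zeta')$ be the projection $G\times_{G'}E'\twoheadrightarrow G$. \textbf{Theorem.} There is an epimorphism $\theta\colon\prod_{G,\,i\in I}H_i\twoheadrightarrow\prod_{G',\,i\in I'}H'_i$ such that the square with $\theta$, $\eta_I$, $\eta'_{I'}$ and $\pi$ is commutative and semi-cartesian if and only if (a) $|I'_{\zeta'}|\le|I_{\zeta}|$ for every indecomposable cover $\zeta'$ of $G'$ with non-abelian kernel, where $\zeta=\operatorname{Inf}_\pi(\zeta')$; and (b) $\operatorname{Im}(\operatorname{Inf}_{\pi,A'}\circ S'_{A'})\subseteq\operatorname{Im}S_A$ and $\dim\operatorname{Ker}(\operatorname{Inf}_{\pi,A'}\circ S'_{A'})\le\dim\operatorname{Ker}S_A$ (as cardinals, over $\operatorname{End}_{G'}(A')=\operatorname{End}_G(A)$)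 for every finite simple $G'$-module $A'$, where $A=\operatorname{Inf}_\pi(A')$. -/

import Mathlib

universe u

/-! ### Covers of profinite groups -/

section Section

variable {G E : Type u} [Group G] [TopologicalSpace G] [IsTopologicalGroup G]
  [TotallyDisconnectedSpace G] [Group E] [TopologicalSpace E] [IsTopologicalGroup E]
  [CompactSpace E] [TotallyDisconnectedSpace E]

/-- Every continuous epimorphism of profinite groups has a continuous section (as a map of
topological spaces). -/
theorem exists_continuous_section (p : E →ₜ* G) (hp : Function.Surjective p) :
    ∃ u : G → E, Continuous u ∧ ∀ g, p (u g) = g := by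
  classical
  let T : Set (Set E) := {C | IsClosed C ∧ (∀ g, ∃ c ∈ C, p c = g) ∧
    ∃ S : Subgroup E, S ≤ p.toMonoidHom.ker ∧
      ∀ c ∈ C, ∀ k ∈ p.toMonoidHom.ker, c * k ∈ C ↔ k ∈ S}
  have huniv : (Set.univ : Set E) ∈ T :=
    ⟨isClosed_univ, fun g => (hp g).imp fun x hx => ⟨Set.mem_univ _, hx⟩,
      p.toMonoidHom.ker, le_rfl, fun c _ k hk => by simpa using hk⟩
  obtain ⟨C, -, hC⟩ := zorn_superset_nonempty T (by
    intro c hcT hc hne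
    refine ⟨⋂₀ c, ⟨isClosed_sInter fun s hs => (hcT hs).1, ?_, ?_⟩,
      fun s hs => Set.sInter_subset_of_mem hs⟩
    · intro g
      have hfib : IsClosed (p ⁻¹' {g}) := isClosed_singleton.preimage p.continuous_toFun
      have : Nonempty c := hne.to_subtype
      have := IsCompact.nonempty_iInter_of_directed_nonempty_isCompact_isClosed
        (fun s : c => (s : Set E) ∩ p ⁻¹' {g})
        (by
          intro s t
          rcases hc.total s.2 t.2 with h | h
          · exact ⟨s, subset_rfl, Set.inter_subset_inter_left _ h⟩
          · exact ⟨t, Set.inter_subset_inter_left _ h, subset_rfl⟩)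
        (fun s => by
          obtain ⟨x, hx, hxg⟩ := (hcT s.2).2.1 g
          exact ⟨x, hx, hxg⟩)
        (fun s => ((hcT s.2).1.inter hfib).isCompact)
        (fun s => (hcT s.2).1.inter hfib)
      obtain ⟨x, hx⟩ := this
      rw [Set.mem_iInter] at hx
      obtain ⟨s₀⟩ := ‹Nonempty c›
      exact ⟨x, fun s hs => (hx ⟨s, hs⟩).1, (hx s₀).2⟩
    · choose! S hS using fun s (hs : s ∈ c) => (hcT hs).2.2
      refine ⟨⨅ s : c, S s, ?_, ?_⟩
      · obtain ⟨s₀, hs₀⟩ := hne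
        exact (iInf_le _ (⟨s₀, hs₀⟩ : c)).trans (hS s₀ hs₀).1
      · intro x hx k hk
        simp only [Set.mem_sInter, Subgroup.mem_iInf, Subtype.forall]
        exact forall₂_congr fun s hs => (hS s hs).2 x (hx s hs) k hk)
    Set.univ huniv
  obtain ⟨⟨hcl, hsurj, S, hSK, hS⟩, hmin⟩ := hC
  have hSbot : ∀ s ∈ S, s = 1 := by
    by_contra! hcon
    obtain ⟨s, hsS, hs1⟩ := hcon
    obtain ⟨U, hU⟩ := ProfiniteGrp.exist_openNormalSubgroup_sub_open_nhds_of_one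
      (isOpen_compl_singleton (x := s)) (by simpa using hs1.symm)
    have hsU : s ∉ U.toSubgroup := fun h => by simpa using hU h
    let W : Subgroup E := S ⊔ U.toSubgroup
    have hWopen : IsOpen (W : Set E) := Subgroup.isOpen_mono le_sup_right U.isOpen
    let r : E → E := fun x => ((x : E ⧸ W)).out
    have hr : ∀ x, (r x)⁻¹ * x ∈ W := fun x => by
      rw [← QuotientGroup.eq]; exact QuotientGroup.out_eq' _
    have hrk : ∀ x, ∀ k ∈ S, r (x * k) = r x := fun x k hk => by
      have : ((x * k : E) : E ⧸ W) = (x : E ⧸ W) := by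
        rw [eq_comm, QuotientGroup.eq]
        simpa using Subgroup.mem_sup_left hk
      simp only [r, this]
    have hrcont : Continuous r := by
      have : DiscreteTopology (E ⧸ W) := QuotientGroup.discreteTopology hWopen
      exact (continuous_of_discreteTopology (f := fun q : E ⧸ W => q.out)).comp
        continuous_quotient_mk'
    have hUcl : IsClosed (U.toSubgroup : Set E) := Subgroup.isClosed_of_isOpen _ U.isOpen
    let C' : Set E := C ∩ {x | (r x)⁻¹ * x ∈ U.toSubgroup}
    have hC' : C' ∈ T := by
      refine ⟨hcl.inter (hUcl.preimage (hrcont.inv.mul continuous_id)), ?_, S ⊓ U.toSubgroup,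
        inf_le_left.trans hSK, ?_⟩
      · intro g
        obtain ⟨x, hxC, hxg⟩ := hsurj g
        have h1 : (r x)⁻¹ * x ∈ ((S ⊔ U.toSubgroup : Subgroup E) : Set E) := hr x
        rw [sup_comm, Subgroup.normal_mul] at h1
        obtain ⟨v, hv, k, hk, hvk⟩ := h1
        have hk' : k⁻¹ ∈ S := S.inv_mem hk
        refine ⟨x * k⁻¹, ⟨(hS x hxC _ (hSK hk')).2 hk', ?_⟩, ?_⟩
        · change (r (x * k⁻¹))⁻¹ * (x * k⁻¹) ∈ U.toSubgroup
          rw [hrk x _ hk', ← mul_assoc, ← hvk]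
          simpa using hv
        · have : p k⁻¹ = 1 := hSK hk'
          rw [map_mul, this, mul_one, hxg]
      · rintro x ⟨hxC, hxU⟩ k hk
        have hxU : (r x)⁻¹ * x ∈ U.toSubgroup := hxU
        rw [Set.mem_inter_iff, hS x hxC k hk, Subgroup.mem_inf]
        refine and_congr_right fun hkS => ?_
        change (r (x * k))⁻¹ * (x * k) ∈ U.toSubgroup ↔ _
        rw [hrk x k hkS, ← mul_assoc]
        exact Subgroup.mul_mem_cancel_left _ hxU
    have hle : C ⊆ C' := hmin hC' Set.inter_subset_left
    obtain ⟨x, hxC, -⟩ := hsurj 1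
    have hx1 : (r x)⁻¹ * x ∈ U.toSubgroup := (hle hxC).2
    have hx2 : (r (x * s))⁻¹ * (x * s) ∈ U.toSubgroup :=
      (hle ((hS x hxC s (hSK hsS)).2 hsS)).2
    rw [hrk x s hsS, ← mul_assoc] at hx2
    exact hsU ((Subgroup.mul_mem_cancel_left _ hx1).1 hx2)
  choose u huC hu using hsurj
  have hinj : ∀ x ∈ C, u (p x) = x := by
    intro x hx
    have hk : x⁻¹ * u (p x) ∈ p.toMonoidHom.ker := by
      change p (x⁻¹ * u (p x)) = 1
      rw [map_mul, hu, map_inv, inv_mul_cancel]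
    have := hSbot _ ((hS x hx _ hk).1 (by simpa using huC (p x)))
    exact (inv_mul_eq_one.1 this).symm
  refine ⟨u, continuous_iff_isClosed.2 fun s hs => ?_, hu⟩
  have : u ⁻¹' s = p '' (C ∩ s) := by
    ext g
    constructor
    · intro h
      exact ⟨u g, ⟨huC g, h⟩, hu g⟩
    · rintro ⟨x, ⟨hxC, hxs⟩, rfl⟩
      change u (p x) ∈ s
      rwa [hinj x hxC]
  rw [this]
  exact ((hcl.inter hs).isCompact.image p.continuous_toFun).isClosed

end Section

/-- A cover of `G`: a continuous epimorphism from a profinite group onto `G`. -/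
structure ProfiniteCover (G : Type u) [Group G] [TopologicalSpace G] where
  /-- the covering profinite group -/
  E : Type u
  [group : Group E]
  [topologicalSpace : TopologicalSpace E]
  [isTopologicalGroup : IsTopologicalGroup E]
  [compactSpace : CompactSpace E]
  [totallyDisconnectedSpace : TotallyDisconnectedSpace E]
  /-- the epimorphism -/
  map : E →ₜ* G
  surjective : Function.Surjective map

namespace ProfiniteCover

attribute [instance] group topologicalSpace isTopologicalGroup compactSpace
  totallyDisconnectedSpace

variable {G G' : Type u} [Group G] [TopologicalSpace G] [Group G'] [TopologicalSpace G']

/-- The kernel of a cover. -/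
def ker (p : ProfiniteCover G) : Subgroup p.E := p.map.toMonoidHom.ker

theorem mem_ker {p : ProfiniteCover G} {x : p.E} : x ∈ p.ker ↔ p.map x = 1 := Iff.rfl

theorem conj_mem_ker (p : ProfiniteCover G) (h : p.E) (x : p.ker) : h * x * h⁻¹ ∈ p.ker :=
  (MonoidHom.normal_ker p.map.toMonoidHom).conj_mem x x.2 h

/-- A cover is indecomposable if it is not an isomorphism and in each factorization of it into
two epimorphisms of profinite groups one of the two is an isomorphism. -/
def IsIndecomposable (p : ProfiniteCover G) : Prop :=
  ¬ IsHomeomorph p.map ∧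
    ∀ (q : ProfiniteCover G) (ψ : p.E →ₜ* q.E), Function.Surjective ψ →
      (∀ x, q.map (ψ x) = p.map x) → IsHomeomorph ψ ∨ IsHomeomorph q.map

/-- Isomorphism of covers of `G` (over `G`). -/
def Iso (p q : ProfiniteCover G) : Prop :=
  ∃ e : p.E ≃ₜ* q.E, ∀ x, q.map (e x) = p.map x

/-- The kernel of the cover is not abelian. -/
def HasNonabelianKernel (p : ProfiniteCover G) : Prop :=
  ∃ x ∈ p.ker, ∃ y ∈ p.ker, x * y ≠ y * x

/-- The underlying group of the fiber product over `G` of a family of covers of `G`, as the group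
of all `(g, (hᵢ)ᵢ)` with `ηᵢ(hᵢ) = g` for all `i`. The redundant coordinate `g` makes the
fiber product of the empty family equal to `G`. -/
def fiberProductSubgroup {I : Type u} (η : I → ProfiniteCover G) :
    Subgroup (G × ∀ i, (η i).E) where
  carrier := {x | ∀ i, (η i).map (x.2 i) = x.1}
  mul_mem' := fun ha hb i => by simp [ha i, hb i]
  one_mem' := fun i => by simp
  inv_mem' := fun ha i => by simp [ha i]

section Profinite

variable [IsTopologicalGroup G] [CompactSpace G] [TotallyDisconnectedSpace G]
  [IsTopologicalGroup G'] [CompactSpace G'] [TotallyDisconnectedSpace G']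

/-- The fiber product over `G` of a family of covers of `G`, with its structure map onto `G`. -/
def fiberProduct {I : Type u} (η : I → ProfiniteCover G) : ProfiniteCover G where
  E := fiberProductSubgroup η
  compactSpace := by
    refine isCompact_iff_compactSpace.1 (IsClosed.isCompact ?_)
    have : (fiberProductSubgroup η : Set (G × ∀ i, (η i).E)) =
        ⋂ i, {x | (η i).map (x.2 i) = x.1} := by
      ext x; simp [fiberProductSubgroup]
    rw [this]
    exact isClosed_iInter fun i => isClosed_eq
      ((η i).map.continuous_toFun.comp ((continuous_apply i).comp continuous_snd)) continuous_fst
  map :=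
    { toMonoidHom := (MonoidHom.fst G (∀ i, (η i).E)).comp (fiberProductSubgroup η).subtype
      continuous_toFun := continuous_fst.comp continuous_subtype_val }
  surjective := fun g =>
    ⟨⟨(g, fun i => ((η i).surjective g).choose), fun i => ((η i).surjective g).choose_spec⟩, rfl⟩

/-- The underlying group `G ×_{G'} H'` of the inflation of a cover `H' → G'` along `π`. -/
def inflSubgroup (π : G →ₜ* G') (p : ProfiniteCover G') : Subgroup (G × p.E) where
  carrier := {x | p.map x.2 = π x.1}
  mul_mem' := fun {a b} (ha : _ = _) (hb : _ = _) => by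
    change p.map (a.2 * b.2) = π (a.1 * b.1); simp [ha, hb]
  one_mem' := by simp
  inv_mem' := fun {a} (ha : _ = _) => by
    change p.map (a.2)⁻¹ = π (a.1)⁻¹; simp [ha]

/-- The inflation of a cover `H' → G'` along `π : G → G'`, that is, the projection of
`G ×_{G'} H'` onto `G`. -/
def infl (π : G →ₜ* G') (p : ProfiniteCover G') : ProfiniteCover G where
  E := inflSubgroup π p
  compactSpace := by
    refine isCompact_iff_compactSpace.1 (IsClosed.isCompact ?_)
    exact isClosed_eq (p.map.continuous_toFun.comp continuous_snd)
      (π.continuous_toFun.comp continuous_fst)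
  map :=
    { toMonoidHom := (MonoidHom.fst G p.E).comp (inflSubgroup π p).subtype
      continuous_toFun := continuous_fst.comp continuous_subtype_val }
  surjective := fun g =>
    ⟨⟨(g, (p.surjective (π g)).choose), (p.surjective (π g)).choose_spec⟩, rfl⟩

end Profinite

end ProfiniteCover

/-- The commutative square with top `θ : H → H'`, bottom `π : G → G'` and with vertical covers
`p : H → G` and `p' : H' → G'` is semi-cartesian: `θ` maps `Ker p` onto `Ker p'`. -/
def IsSemiCartesian {G G' : Type u} [Group G] [TopologicalSpace G] [Group G']
    [TopologicalSpace G'] (π : G →ₜ* G') (p : ProfiniteCover G) (p' : ProfiniteCover G')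
    (θ : p.E →ₜ* p'.E) : Prop :=
  (∀ x, p'.map (θ x) = π (p.map x)) ∧ p.ker.map θ.toMonoidHom = p'.ker

/-! ### Finite simple modules and the second cohomology group

An abelian group `A` with an action of `G` is given by `ρ : G →* AddMonoid.End A`. The finite
modules `A` carry the discrete topology, so a map into `A` is continuous iff it is locally
constant. -/

/-- The `G`-module `A` is a finite simple (continuous) `G`-module. -/
structure IsFiniteSimpleModule {G A : Type u} [Group G] [TopologicalSpace G] [AddCommGroup A]
    (ρ : G →* AddMonoid.End A) : Prop where
  finite : Finite A
  isOpen_stabilizer : ∀ a, IsOpen {g | ρ g a = a}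
  nontrivial : Nontrivial A
  eq_bot_or_eq_top : ∀ B : AddSubgroup A, (∀ g, ∀ b ∈ B, ρ g b ∈ B) → B = ⊥ ∨ B = ⊤

section Cohomology

variable {G G' A : Type u} [Group G] [TopologicalSpace G] [Group G'] [TopologicalSpace G']
  [AddCommGroup A]

/-- The inflation of the `G'`-module `A` along `π : G → G'`: the group `A` on which `G` acts
via `π`. -/
def inflModule (π : G →ₜ* G') (ρ : G' →* AddMonoid.End A) : G →* AddMonoid.End A :=
  ρ.comp π.toMonoidHom

/-- The ring `End_G(A)`. -/
def endRing (ρ : G →* AddMonoid.End A) : Subring (AddMonoid.End A) where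
  carrier := {α | ∀ g a, α (ρ g a) = ρ g (α a)}
  mul_mem' := fun {α β} ha hb g a => by
    change α (β (ρ g a)) = ρ g (α (β a)); rw [hb, ha]
  one_mem' := fun _ _ => rfl
  add_mem' := fun {α β} ha hb g a => by
    change α (ρ g a) + β (ρ g a) = ρ g (α a + β a); rw [ha, hb, map_add]
  zero_mem' := fun g a => (map_zero (ρ g)).symm
  neg_mem' := fun {α} ha g a => by
    change -(α (ρ g a)) = ρ g (-(α a)); rw [ha, map_neg]

theorem endRing_smul_apply (ρ : G →* AddMonoid.End A) (α : endRing ρ) (g : G) (a : A) :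
    α • ρ g a = ρ g (α • a) := α.2 g a

/-- The coboundary of a non-homogeneous `1`-cochain, as a linear map over `End_G(A)`. -/
def coboundary₁ (ρ : G →* AddMonoid.End A) : (G → A) →ₗ[endRing ρ] (G → G → A) where
  toFun c := fun σ τ => ρ σ (c τ) - c (σ * τ) + c σ
  map_add' c d := by
    funext σ τ
    simp only [Pi.add_apply, map_add]; abel
  map_smul' α c := by
    funext σ τ
    simp only [Pi.smul_apply, RingHom.id_apply, smul_add, smul_sub, endRing_smul_apply]

/-- The coboundary of a non-homogeneous `2`-cochain, as a linear map over `End_G(A)`. -/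
def coboundary₂ (ρ : G →* AddMonoid.End A) : (G → G → A) →ₗ[endRing ρ] (G → G → G → A) where
  toFun f := fun σ τ υ => ρ σ (f τ υ) - f (σ * τ) υ + f σ (τ * υ) - f σ τ
  map_add' c d := by
    funext σ τ υ
    simp only [Pi.add_apply, map_add]; abel
  map_smul' α c := by
    funext σ τ υ
    simp only [Pi.smul_apply, RingHom.id_apply, smul_add, smul_sub, endRing_smul_apply]

/-- Continuous non-homogeneous `1`-cochains. -/
def cochains₁ (ρ : G →* AddMonoid.End A) : Submodule (endRing ρ) (G → A) where
  carrier := {c | IsLocallyConstant c}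
  add_mem' := fun ha hb => ha.add hb
  zero_mem' := IsLocallyConstant.const 0
  smul_mem' := fun α _ hc => hc.comp (α • ·)

/-- Continuous non-homogeneous `2`-cochains. -/
def cochains₂ (ρ : G →* AddMonoid.End A) : Submodule (endRing ρ) (G → G → A) where
  carrier := {f | IsLocallyConstant fun x : G × G => f x.1 x.2}
  add_mem' := fun ha hb => ha.add hb
  zero_mem' := IsLocallyConstant.const 0
  smul_mem' := fun α _ hf => hf.comp (α • ·)

/-- Continuous non-homogeneous `2`-cocycles. -/
def cocycles₂ (ρ : G →* AddMonoid.End A) : Submodule (endRing ρ) (G → G → A) :=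
  cochains₂ ρ ⊓ LinearMap.ker (coboundary₂ ρ)

/-- The coboundaries of continuous `1`-cochains. -/
def coboundaries₂ (ρ : G →* AddMonoid.End A) : Submodule (endRing ρ) (G → G → A) :=
  (cochains₁ ρ).map (coboundary₁ ρ)

/-- The coboundaries, inside the module of cocycles. -/
abbrev coboundariesInCocycles₂ (ρ : G →* AddMonoid.End A) :
    Submodule (endRing ρ) (cocycles₂ ρ) :=
  (coboundaries₂ ρ).submoduleOf (cocycles₂ ρ)

/-- The second continuous cohomology group `H²(G, A)` of `G` with coefficients in the discrete
module `A`, as a vector space over `End_G(A)`. -/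
abbrev H2 (ρ : G →* AddMonoid.End A) : Type u :=
  cocycles₂ ρ ⧸ coboundariesInCocycles₂ ρ

/-- The inclusion of `End_{G'}(A)` into `End_G(A)`, where `G` acts on `A` via `π : G → G'`. -/
def inflEnd (π : G →ₜ* G') (ρ : G' →* AddMonoid.End A) : endRing ρ →+* endRing (inflModule π ρ) :=
  Subring.inclusion fun _ hα g a => hα (π g) a

/-- The inflation of cocycles along `π`. -/
def inflCocycles₂ (π : G →ₜ* G') (ρ : G' →* AddMonoid.End A) :
    cocycles₂ ρ →ₛₗ[inflEnd π ρ] cocycles₂ (inflModule π ρ) where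
  toFun f := ⟨fun σ τ => f.1 (π σ) (π τ), by
    refine ⟨?_, ?_⟩
    · exact IsLocallyConstant.comp_continuous f.2.1
        ((π.continuous_toFun.comp continuous_fst).prodMk
          (π.continuous_toFun.comp continuous_snd))
    · refine LinearMap.mem_ker.2 (funext fun σ => funext fun τ => funext fun υ => ?_)
      have := congrFun (congrFun (congrFun (LinearMap.mem_ker.1 f.2.2) (π σ)) (π τ)) (π υ)
      change ρ (π σ) (f.1 (π τ) (π υ)) - f.1 (π (σ * τ)) (π υ) + f.1 (π σ) (π (τ * υ)) -
        f.1 (π σ) (π τ) = 0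
      rw [map_mul, map_mul]
      exact this⟩
  map_add' _ _ := rfl
  map_smul' _ _ := rfl

/-- The inflation map `H²(G', A) → H²(G, A)` along `π`, where `G` acts on `A` via `π`. -/
def inflH2 (π : G →ₜ* G') (ρ : G' →* AddMonoid.End A) :
    H2 ρ →ₛₗ[inflEnd π ρ] H2 (inflModule π ρ) :=
  Submodule.mapQ _ _ (inflCocycles₂ π ρ) (by
    rintro f ⟨c, hc, hcf⟩
    refine ⟨fun g => c (π g), ?_, ?_⟩
    · exact IsLocallyConstant.comp_continuous (g := c) hc π.continuous_toFun
    · funext σ τ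
      have := congrFun (congrFun hcf (π σ)) (π τ)
      change ρ (π σ) (c (π τ)) - c (π (σ * τ)) + c (π σ) = f.1 (π σ) (π τ)
      rw [map_mul]
      exact this)

end Cohomology

/-! ### The invariant `S` of a cover -/

namespace ProfiniteCover

variable {G A : Type u} [Group G] [TopologicalSpace G] [AddCommGroup A]

/-- The kernel of the cover is abelian and, with the action of `G` induced by conjugation
(`g` acts as conjugation by any `h` over `g`), isomorphic to the `G`-module `A`. -/
def KernelIso (p : ProfiniteCover G) (ρ : G →* AddMonoid.End A) : Prop :=
  ∃ e : p.ker ≃ A, (∀ x y, e (x * y) = e x + e y) ∧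
    ∀ (h : p.E) (x : p.ker), e ⟨h * x * h⁻¹, p.conj_mem_ker h x⟩ = ρ (p.map h) (e x)

/-- The space `B^* = Hom_G(B, A)` of continuous `G`-homomorphisms from the kernel `B` of a cover
to the finite module `A`, where `G` acts on `B` by conjugation. -/
def kerDual (p : ProfiniteCover G) (ρ : G →* AddMonoid.End A) :
    Submodule (endRing ρ) (p.ker → A) where
  carrier := {φ | IsLocallyConstant φ ∧ (∀ x y, φ (x * y) = φ x + φ y) ∧
    ∀ (h : p.E) (x : p.ker), φ ⟨h * x * h⁻¹, p.conj_mem_ker h x⟩ = ρ (p.map h) (φ x)}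
  add_mem' := by
    rintro φ ψ ⟨h1, h2, h3⟩ ⟨k1, k2, k3⟩
    refine ⟨h1.add k1, fun x y => ?_, fun h x => ?_⟩
    · simp only [Pi.add_apply, h2, k2]; abel
    · simp only [Pi.add_apply, h3, k3, map_add]
  zero_mem' := ⟨IsLocallyConstant.const 0, fun _ _ => by simp, fun _ _ => by simp⟩
  smul_mem' := by
    rintro α φ ⟨h1, h2, h3⟩
    refine ⟨h1.comp (α • ·), fun x y => ?_, fun h x => ?_⟩
    · simp only [Pi.smul_apply, h2, smul_add]
    · simp only [Pi.smul_apply, h3, endRing_smul_apply]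

/-- The factor set `f(σ, τ) = u(σ) u(τ) u(στ)⁻¹` of a section `u` of a cover, with values in the
kernel. -/
def factorSet (p : ProfiniteCover G) (u : G → p.E) (hu : ∀ g, p.map (u g) = g) (σ τ : G) :
    p.ker :=
  ⟨u σ * u τ * (u (σ * τ))⁻¹, by simp [mem_ker, hu]⟩

theorem comp_factorSet_mem (p : ProfiniteCover G) (ρ : G →* AddMonoid.End A) [IsTopologicalGroup G]
    (u : G → p.E) (huc : Continuous u) (hu : ∀ g, p.map (u g) = g) (φ : p.kerDual ρ) :
    (fun σ τ => φ.1 (p.factorSet u hu σ τ)) ∈ cocycles₂ ρ := by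
  obtain ⟨φ, h1, h2, h3⟩ := φ
  refine ⟨?_, LinearMap.mem_ker.2 (funext fun σ => funext fun τ => funext fun υ => ?_)⟩
  · refine IsLocallyConstant.comp_continuous
      (f := fun x : G × G => p.factorSet u hu x.1 x.2) h1 (Continuous.subtype_mk ?_ _)
    exact ((huc.comp continuous_fst).mul (huc.comp continuous_snd)).mul
      (huc.comp (continuous_fst.mul continuous_snd)).inv
  · have e1 := h3 (u σ) (p.factorSet u hu τ υ)
    rw [hu] at e1
    have key : (⟨u σ * p.factorSet u hu τ υ * (u σ)⁻¹, p.conj_mem_ker _ _⟩ : p.ker) *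
        p.factorSet u hu σ (τ * υ) = p.factorSet u hu σ τ * p.factorSet u hu (σ * τ) υ := by
      apply Subtype.ext
      simp only [factorSet, Subgroup.coe_mul, mul_assoc]
      group
    have e2 := congrArg φ key
    rw [h2, h2, e1] at e2
    change ρ σ (φ _) - φ _ + φ _ - φ _ = 0
    rw [sub_add_eq_add_sub, e2]
    abel

section Profinite

variable [IsTopologicalGroup G] [CompactSpace G] [TotallyDisconnectedSpace G]

/-- A continuous section of the cover. -/
noncomputable def contSection (p : ProfiniteCover G) : G → p.E :=
  (exists_continuous_section p.map p.surjective).choose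

theorem continuous_contSection (p : ProfiniteCover G) : Continuous p.contSection :=
  (exists_continuous_section p.map p.surjective).choose_spec.1

theorem map_contSection (p : ProfiniteCover G) (g : G) : p.map (p.contSection g) = g :=
  (exists_continuous_section p.map p.surjective).choose_spec.2 g

/-- The linear map `S : B^* → H²(G, A)` attached to a cover with kernel `B`: it sends `φ` to the
class of `φ ∘ f`, where `f` is the factor set of a continuous section of the cover, so `f`
represents the class in `H²(G, B)` of the extension of `G` by `B` if `B` is abelian. By
`transgression_apply` below, the choice of the section does not matter. -/
noncomputable def transgression (p : ProfiniteCover G) (ρ : G →* AddMonoid.End A) :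
    p.kerDual ρ →ₗ[endRing ρ] H2 ρ :=
  (coboundariesInCocycles₂ ρ).mkQ.comp (σ₁₂ := RingHom.id _) (M₂ := cocycles₂ ρ)
    { toFun := fun φ => ⟨fun σ τ => φ.1 (p.factorSet p.contSection p.map_contSection σ τ),
        p.comp_factorSet_mem ρ _ p.continuous_contSection p.map_contSection φ⟩
      map_add' := fun _ _ => rfl
      map_smul' := fun _ _ => rfl }

theorem transgression_apply (p : ProfiniteCover G) (ρ : G →* AddMonoid.End A)
    (u : G → p.E) (huc : Continuous u) (hu : ∀ g, p.map (u g) = g) (φ : p.kerDual ρ) :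
    p.transgression ρ φ = (coboundariesInCocycles₂ ρ).mkQ
      ⟨fun σ τ => φ.1 (p.factorSet u hu σ τ), p.comp_factorSet_mem ρ u huc hu φ⟩ := by
  have hv := p.map_contSection
  have hvc := p.continuous_contSection
  refine (Submodule.Quotient.eq _).2 ?_
  set v := p.contSection with hvdef
  obtain ⟨φ, h1, h2, h3⟩ := φ
  -- `v g = d g * u g` with `d g` in the kernel
  let d : G → p.ker := fun g => ⟨v g * (u g)⁻¹, by simp [mem_ker, hu, hv]⟩
  have hd : Continuous d := Continuous.subtype_mk (hvc.mul huc.inv) _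
  refine ⟨fun g => φ (d g), IsLocallyConstant.comp_continuous (f := d) h1 hd, ?_⟩
  funext σ τ
  have e1 := h3 (u σ) (d τ)
  rw [hu] at e1
  have key : p.factorSet v hv σ τ * d (σ * τ) =
      d σ * (⟨u σ * d τ * (u σ)⁻¹, p.conj_mem_ker _ _⟩ : p.ker) * p.factorSet u hu σ τ := by
    apply Subtype.ext
    simp only [factorSet, d, Subgroup.coe_mul, mul_assoc]
    group
  have e2 := congrArg φ key
  rw [h2, h2, h2, e1] at e2
  change ρ σ (φ (d τ)) - φ (d (σ * τ)) + φ (d σ) =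
    φ (p.factorSet v hv σ τ) - φ (p.factorSet u hu σ τ)
  rw [eq_sub_of_add_eq e2]
  abel

/-- For a family `η` of covers of `G` and a `G`-module `A`, the fiber product `H_A` of those
members of the family whose kernel is isomorphic to `A`. -/
def isotypicFiberProduct {I : Type u} (η : I → ProfiniteCover G) (ρ : G →* AddMonoid.End A) :
    ProfiniteCover G :=
  fiberProduct fun i : {i : I // (η i).KernelIso ρ} => η i

/-- The vector space `V_A = Hom_G(B_A, A)`, where `B_A` is the kernel of the fiber product `H_A`
of those members of the family `η` whose kernel is isomorphic to `A`. -/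
abbrev V {I : Type u} (η : I → ProfiniteCover G) (ρ : G →* AddMonoid.End A) : Type u :=
  (isotypicFiberProduct η ρ).kerDual ρ

/-- The linear map `S_A : V_A → H²(G, A)` attached to the family `η`. -/
noncomputable def S {I : Type u} (η : I → ProfiniteCover G) (ρ : G →* AddMonoid.End A) :
    V η ρ →ₗ[endRing ρ] H2 ρ :=
  (isotypicFiberProduct η ρ).transgression ρ

end Profinite

end ProfiniteCover

/-! The kernel of an indecomposable cover is a finite minimal normal subgroup, so it is either
non-abelian with trivial centre or a finite simple module. The kernel of the fiber product is the
direct product of the kernels of the factors, and θ makes the square semi-cartesian exactly when it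
maps the kernel over `G` onto the kernel over `G'`. The two kinds of factors do not interact, which
is why (a) and (b) are separate conditions.

Necessity. A map of the fiber product onto a cover with minimal non-abelian kernel is non-trivial on
exactly one factor, because distinct factors commute elementwise (`exists_factor_fiberProj`). That
factor is then an inflation of the target, and distinct targets use distinct factors; this is (a).
For a simple module, pulling back along θ embeds `V'` semilinearly in `V`. Since θ covers π, pulling
back is compatible with inflation of the extension classes (`inflH2_transgression`). The image and
the kernel of the inflated `S'` therefore embed in those of `S`; this is (b).

Sufficiency. Condition (a) matches each non-abelian factor over `G'` with its own factor over `G`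
(`exists_matching`). By linear algebra, (b) gives an injective semilinear `T : V' → V` with `S ∘ T =
Inf ∘ S'` (`exists_injective_comp_eq`). Equality of classes lets `T` of a coordinate function extend
from the kernel to a homomorphism of covers (`exists_hom_of_transgression_eq`). These components
assemble to θ. By compactness and minimality, θ is onto on kernels as soon as no component is
trivial on the common kernel of finitely many others (`kerMap_fiberLift_surjective`). For
non-abelian components this follows from the injectivity of the matching, and for abelian ones from
the injectivity of `T` and a Goursat argument (`exists_eq_sum_of_commonKer`). -/

namespace ProfiniteCover

/-! ### Quotients of profinite groups -/

section Topological

/-- A closed subgroup is the intersection of the open subgroups containing it. If `a⁻¹ * b ∉ N`,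
some open `M ≥ N` omits `a⁻¹ * b`; the coset `aM` is clopen and a union of cosets of `N`, so its
image separates the two points. -/
theorem totallyDisconnectedSpace_quotient {E : Type u} [Group E] [TopologicalSpace E]
    [IsTopologicalGroup E] [CompactSpace E] [TotallyDisconnectedSpace E] (N : Subgroup E)
    [N.Normal] (hN : IsClosed (N : Set E)) : TotallyDisconnectedSpace (E ⧸ N) := by
  suffices TotallySeparatedSpace (E ⧸ N) from inferInstance
  refine totallySeparatedSpace_iff_exists_isClopen.2 fun x y hxy => ?_
  induction x using QuotientGroup.induction_on with | _ a
  induction y using QuotientGroup.induction_on with | _ b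
  have hab : a⁻¹ * b ∉ N := fun h => hxy (QuotientGroup.eq.2 h)
  have hsInf := ProfiniteGrp.closedSubgroup_eq_sInf_open (⟨N, hN⟩ : ClosedSubgroup E)
  have : a⁻¹ * b ∉ sInf {M : Subgroup E | IsOpen (M : Set E) ∧ N ≤ M} := by
    intro h; exact hab (by rw [← hsInf] at h; exact h)
  simp only [Subgroup.mem_sInf, not_forall] at this
  obtain ⟨M, ⟨hMo, hNM⟩, hM⟩ := this
  let f : E → E ⧸ N := QuotientGroup.mk
  have hpre : f ⁻¹' (f '' {x | a⁻¹ * x ∈ M}) = {x | a⁻¹ * x ∈ M} := by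
    refine Set.Subset.antisymm ?_ (Set.subset_preimage_image _ _)
    rintro x ⟨z, hz, hzx⟩
    have h1 : z⁻¹ * x ∈ M := hNM (QuotientGroup.eq.1 hzx)
    have := M.mul_mem hz h1
    simpa [mul_assoc] using this
  have hclopen : IsClopen {x | a⁻¹ * x ∈ M} :=
    ⟨(Subgroup.isClosed_of_isOpen M hMo).preimage (continuous_const_mul a⁻¹),
      hMo.preimage (continuous_const_mul a⁻¹)⟩
  refine ⟨f '' {x | a⁻¹ * x ∈ M}, ?_, ⟨a, by simp [M.one_mem], rfl⟩, ?_⟩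
  · rw [← (QuotientGroup.isQuotientMap_mk (N := N)).isClopen_preimage]
    change IsClopen (f ⁻¹' _)
    rwa [hpre]
  · intro hb
    have : b ∈ f ⁻¹' (f '' {x | a⁻¹ * x ∈ M}) := hb
    rw [hpre] at this
    exact hM this

/-- A continuous homomorphism of a compact group that is trivial on the kernel of a continuous
epimorphism factors through it. -/
theorem exists_comp_eq {A B C : Type u} [Group A] [TopologicalSpace A] [CompactSpace A]
    [Group B] [TopologicalSpace B] [T2Space B] [Group C] [TopologicalSpace C]
    (a : A →ₜ* B) (ha : Function.Surjective a) (b : A →ₜ* C) (h : ∀ x, a x = 1 → b x = 1) :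
    ∃ c : B →ₜ* C, ∀ x, c (a x) = b x := by
  have hq : Topology.IsQuotientMap a :=
    a.continuous_toFun.isClosedMap.isQuotientMap a.continuous_toFun ha
  have hker : a.toMonoidHom.ker ≤ b.toMonoidHom.ker := fun x hx => h x hx
  let c : B →* C := a.toMonoidHom.liftOfSurjective ha ⟨b.toMonoidHom, hker⟩
  have hc : ∀ x, c (a x) = b x := fun x =>
    MonoidHom.liftOfRightInverse_comp_apply _ _ _ ⟨b.toMonoidHom, hker⟩ x
  refine ⟨⟨c, ?_⟩, hc⟩
  change Continuous c
  rw [hq.continuous_iff]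
  exact b.continuous_toFun.congr fun x => (hc x).symm

end Topological

/-! ### Kernels of covers and their minimality -/

variable {G G' : Type u} [Group G] [TopologicalSpace G] [Group G'] [TopologicalSpace G']

instance (p : ProfiniteCover G) : p.ker.Normal := MonoidHom.normal_ker p.map.toMonoidHom

/-- The restriction to kernels of a homomorphism of covers. -/
def kerMap {π : G →ₜ* G'} {p : ProfiniteCover G} {q : ProfiniteCover G'} (f : p.E →ₜ* q.E)
    (hf : ∀ x, q.map (f x) = π (p.map x)) : p.ker →* q.ker :=
  (f.toMonoidHom.comp p.ker.subtype).codRestrict q.ker fun x => by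
    have := hf x; rw [mem_ker.1 x.2, map_one] at this; exact this

theorem continuous_kerMap {π : G →ₜ* G'} {p : ProfiniteCover G} {q : ProfiniteCover G'}
    (f : p.E →ₜ* q.E) (hf : ∀ x, q.map (f x) = π (p.map x)) : Continuous (kerMap f hf) :=
  (f.continuous_toFun.comp continuous_subtype_val).subtype_mk _

/-- Half of the five lemma. It makes the surjectivity of θ automatic once the square is
semi-cartesian. -/
theorem surjective_of_kerMap {π : G →ₜ* G'} (hπ : Function.Surjective π) {p : ProfiniteCover G}
    {q : ProfiniteCover G'} (f : p.E →ₜ* q.E) (hf : ∀ x, q.map (f x) = π (p.map x))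
    (hk : Function.Surjective (kerMap f hf)) : Function.Surjective f := by
  intro y
  obtain ⟨g, hg⟩ := hπ (q.map y)
  obtain ⟨x, rfl⟩ := p.surjective g
  obtain ⟨k, hk⟩ := hk ⟨(f x)⁻¹ * y, by rw [mem_ker, map_mul, map_inv, hf, hg]; simp⟩
  refine ⟨x * k, ?_⟩
  have : f k = (f x)⁻¹ * y := congrArg Subtype.val hk
  rw [map_mul, this]
  simp

theorem isSemiCartesian_iff {π : G →ₜ* G'} {p : ProfiniteCover G} {q : ProfiniteCover G'}
    (f : p.E →ₜ* q.E) : IsSemiCartesian π p q f ↔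
      ∃ hf : ∀ x, q.map (f x) = π (p.map x), Function.Surjective (kerMap f hf) := by
  refine ⟨fun ⟨h1, h2⟩ => ⟨h1, fun y => ?_⟩, fun ⟨h1, h2⟩ => ⟨h1, ?_⟩⟩
  · have : (y : q.E) ∈ p.ker.map f.toMonoidHom := by rw [h2]; exact y.2
    obtain ⟨x, hx, hxy⟩ := this
    exact ⟨⟨x, hx⟩, Subtype.ext hxy⟩
  · ext y
    constructor
    · rintro ⟨x, hx, rfl⟩
      exact (kerMap f h1 ⟨x, hx⟩).2
    · intro hy
      obtain ⟨x, hx⟩ := h2 ⟨y, hy⟩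
      exact ⟨x, x.2, congrArg Subtype.val hx⟩

/-- The kernel of an indecomposable cover is a minimal closed normal subgroup. -/
theorem IsIndecomposable.eq_bot_or_eq_ker {p : ProfiniteCover G} (hp : p.IsIndecomposable)
    (N : Subgroup p.E) [N.Normal] (hN : IsClosed (N : Set p.E)) (hle : N ≤ p.ker) :
    N = ⊥ ∨ N = p.ker := by
  have := totallyDisconnectedSpace_quotient N hN
  let m : (p.E ⧸ N) →* G := QuotientGroup.lift N p.map.toMonoidHom hle
  -- Indecomposability is tested on the factorization of `p` through the quotient by `N`.
  let q : ProfiniteCover G :=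
    { E := p.E ⧸ N
      map := ⟨m, (QuotientGroup.isQuotientMap_mk (N := N)).continuous_iff.2 p.map.continuous_toFun⟩
      surjective := fun g => (p.surjective g).imp' (QuotientGroup.mk (s := N)) fun _ h => h }
  rcases hp.2 q ⟨QuotientGroup.mk' N, continuous_quotient_mk'⟩ (QuotientGroup.mk'_surjective N)
    fun _ => rfl with h | h
  · left
    rw [← QuotientGroup.ker_mk' N]
    exact (MonoidHom.ker_eq_bot_iff _).2 h.injective
  · right
    refine le_antisymm hle fun x hx => ?_
    have : ((x : p.E) : p.E ⧸ N) = 1 := h.injective (hx.trans (map_one q.map).symm)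
    exact (QuotientGroup.eq_one_iff x).1 this

/-- The image of a closed normal subgroup in the kernel of an indecomposable cover is trivial or
everything. -/
theorem IsIndecomposable.eq_one_or_exists {E : Type u} [Group E]
    [TopologicalSpace E] [CompactSpace E] {q : ProfiniteCover G} (hq : q.IsIndecomposable)
    (f : E →ₜ* q.E) (hf : Function.Surjective f) (M : Subgroup E) [hM : M.Normal]
    (hMc : IsClosed (M : Set E)) (hle : ∀ x ∈ M, f x ∈ q.ker) :
    (∀ x ∈ M, f x = 1) ∨ ∀ y ∈ q.ker, ∃ x ∈ M, f x = y := by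
  have : (M.map f.toMonoidHom).Normal := hM.map _ hf
  rcases hq.eq_bot_or_eq_ker (M.map f.toMonoidHom)
    (hMc.isCompact.image f.continuous_toFun).isClosed
    (by rintro _ ⟨x, hx, rfl⟩; exact hle x hx) with h | h
  · left
    intro x hx
    have : f x ∈ M.map f.toMonoidHom := ⟨x, hx, rfl⟩
    rwa [h] at this
  · right
    intro y hy
    rw [← h] at hy
    exact hy

section Separated

variable [T2Space G]

theorem isClosed_ker (p : ProfiniteCover G) : IsClosed (p.ker : Set p.E) :=
  (isClosed_singleton (x := (1 : G))).preimage p.map.continuous_toFun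

instance (p : ProfiniteCover G) : CompactSpace p.ker :=
  isCompact_iff_compactSpace.1 p.isClosed_ker.isCompact

theorem exists_mem_ker_ne_one_of_not_isHomeomorph {p : ProfiniteCover G}
    (hp : ¬ IsHomeomorph p.map) : ∃ x ∈ p.ker, x ≠ 1 := by
  by_contra! h
  refine hp (isHomeomorph_iff_continuous_bijective.2 ⟨p.map.continuous_toFun, ?_, p.surjective⟩)
  exact (injective_iff_map_eq_one p.map).2 h

theorem IsIndecomposable.exists_ne_one {p : ProfiniteCover G}
    (hp : p.IsIndecomposable) : ∃ x : p.ker, x ≠ 1 := by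
  obtain ⟨x, hx, h⟩ := exists_mem_ker_ne_one_of_not_isHomeomorph hp.1
  exact ⟨⟨x, hx⟩, fun h' => h (congrArg Subtype.val h')⟩

/-- An open normal subgroup that omits one non-trivial element of the kernel meets the kernel in a
proper closed normal subgroup, which is trivial by minimality. So the kernel embeds in a finite
quotient. -/
theorem IsIndecomposable.finite_ker {p : ProfiniteCover G}
    (hp : p.IsIndecomposable) : Finite p.ker := by
  obtain ⟨⟨x, hx⟩, hx1⟩ := hp.exists_ne_one
  have hx1 : x ≠ 1 := fun h => hx1 (Subtype.ext h)
  obtain ⟨U, hU⟩ := ProfiniteGrp.exist_openNormalSubgroup_sub_open_nhds_of_one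
    (isOpen_compl_singleton (x := x)) (by simpa using hx1.symm)
  have hxU : x ∉ U.toSubgroup := fun h => by simpa using hU h
  have hbot : p.ker ⊓ U.toSubgroup = ⊥ := by
    refine (hp.eq_bot_or_eq_ker _ (p.isClosed_ker.inter (Subgroup.isClosed_of_isOpen _ U.isOpen))
      inf_le_left).resolve_right fun h => hxU ?_
    have : x ∈ p.ker ⊓ U.toSubgroup := by rw [h]; exact hx
    exact this.2
  have : Finite (p.E ⧸ U.toSubgroup) := Subgroup.quotient_finite_of_isOpen _ U.isOpen
  refine Finite.of_injective (fun y : p.ker => ((y : p.E) : p.E ⧸ U.toSubgroup)) fun y z h => ?_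
  have h1 : ((y⁻¹ * z : p.ker) : p.E) ∈ p.ker ⊓ U.toSubgroup :=
    ⟨(y⁻¹ * z).2, QuotientGroup.eq.1 h⟩
  rw [hbot, Subgroup.mem_bot] at h1
  exact inv_mul_eq_one.1 (Subtype.ext h1)

theorem IsIndecomposable.discreteTopology_ker {p : ProfiniteCover G}
    (hp : p.IsIndecomposable) : DiscreteTopology p.ker :=
  have := hp.finite_ker
  inferInstance

end Separated

/-! ### Fiber products and the factors of their kernels -/

section FiberProduct

variable [IsTopologicalGroup G] [CompactSpace G] [TotallyDisconnectedSpace G]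
  [IsTopologicalGroup G'] [CompactSpace G'] [TotallyDisconnectedSpace G']
  {I : Type u} (η : I → ProfiniteCover G)

/-- The projections of a fiber product. -/
def fiberProj (i : I) : (fiberProduct η).E →ₜ* (η i).E where
  toFun x := x.1.2 i
  map_one' := rfl
  map_mul' _ _ := rfl
  continuous_toFun := (continuous_apply i).comp (continuous_snd.comp continuous_subtype_val)

variable {η}

theorem map_fiberProj (i : I) (x : (fiberProduct η).E) :
    (η i).map (fiberProj η i x) = (fiberProduct η).map x := x.2 i

theorem fiberProduct_ext {x y : (fiberProduct η).E}
    (h : (fiberProduct η).map x = (fiberProduct η).map y)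
    (h' : ∀ i, fiberProj η i x = fiberProj η i y) : x = y :=
  Subtype.ext (Prod.ext h (funext h'))

theorem fiberProj_surjective (i : I) : Function.Surjective (fiberProj η i) := by
  classical
  intro y
  let z : ∀ l, (η l).E := Function.update (fun l => ((η l).surjective ((η i).map y)).choose) i y
  have hz : z i = y := Function.update_self ..
  refine ⟨⟨((η i).map y, z), fun l => ?_⟩, hz⟩
  by_cases h : l = i
  · subst h; exact congrArg _ hz
  · simpa [z, h] using ((η l).surjective ((η i).map y)).choose_spec

/-- The homomorphism into a fiber product with given components. -/
def fiberLift {E : Type u} [Group E] [TopologicalSpace E] (b : E →ₜ* G)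
    (f : ∀ i, E →ₜ* (η i).E) (hf : ∀ i x, (η i).map (f i x) = b x) : E →ₜ* (fiberProduct η).E where
  toFun x := ⟨(b x, fun i => f i x), fun i => hf i x⟩
  map_one' := fiberProduct_ext (map_one b) fun i => map_one (f i)
  map_mul' x y := fiberProduct_ext (map_mul b x y) fun i => map_mul (f i) x y
  continuous_toFun := (b.continuous_toFun.prodMk
    (continuous_pi fun i => (f i).continuous_toFun)).subtype_mk _

open Classical in
/-- The inclusion of a factor in the kernel of a fiber product. -/
noncomputable def kerSingle (i : I) : (η i).ker →* (fiberProduct η).ker where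
  toFun x := ⟨⟨(1, Pi.mulSingle i x.1), fun l => by
    by_cases h : l = i
    · subst h; simpa using mem_ker.1 x.2
    · simp [Pi.mulSingle_eq_of_ne h]⟩, rfl⟩
  map_one' := Subtype.ext (fiberProduct_ext rfl fun l => by
    change (Pi.mulSingle i ((1 : (η i).ker) : (η i).E) : ∀ i, (η i).E) l = 1
    simp)
  map_mul' x y := Subtype.ext (fiberProduct_ext (mul_one _).symm fun l => by
    change (Pi.mulSingle i ((x * y : (η i).ker) : (η i).E) : ∀ i, (η i).E) l = _ * _
    rw [Subgroup.coe_mul, Pi.mulSingle_mul]; rfl)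

theorem fiberProj_kerSingle_self (i : I) (x : (η i).ker) :
    fiberProj η i (kerSingle i x) = x := by
  classical
  exact Pi.mulSingle_eq_same (M := fun i => (η i).E) i x.1

theorem fiberProj_kerSingle_of_ne {i l : I} (h : l ≠ i) (x : (η i).ker) :
    fiberProj η l (kerSingle i x) = 1 := by
  classical
  exact Pi.mulSingle_eq_of_ne (M := fun i => (η i).E) h x.1

/-- The component in a factor of an element of the kernel of a fiber product. -/
def kerProj (i : I) : (fiberProduct η).ker →* (η i).ker :=
  kerMap (π := ContinuousMonoidHom.id G) (fiberProj η i) (map_fiberProj i)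

/-- A closed subgroup that contains all components of an element of the kernel of a fiber product
contains the element. -/
theorem mem_of_kerSingle_mem (D : Subgroup (fiberProduct η).E)
    (hD : IsClosed (D : Set (fiberProduct η).E)) (x : (fiberProduct η).ker)
    (h : ∀ i, (kerSingle i (kerProj i x) : (fiberProduct η).E) ∈ D) :
    (x : (fiberProduct η).E) ∈ D := by
  classical
  -- Truncations of `x` to finite sets of indices are finite products of elements of `D`, and they
  -- converge to `x`.
  have key : ∀ s : Finset I, ∃ y ∈ D, (fiberProduct η).map y = 1 ∧
      ∀ i, fiberProj η i y = if i ∈ s then fiberProj η i x else 1 := by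
    intro s
    induction s using Finset.induction_on with
    | empty => exact ⟨1, D.one_mem, map_one _, fun i => by simp⟩
    | insert a s ha ih =>
      obtain ⟨y, hyD, hy1, hy⟩ := ih
      refine ⟨y * kerSingle a (kerProj a x), D.mul_mem hyD (h a), ?_, fun i => ?_⟩
      · rw [map_mul, hy1, one_mul]
        exact (kerSingle a (kerProj a x)).2
      · rw [map_mul, hy]
        by_cases hi : i = a
        · subst hi
          rw [fiberProj_kerSingle_self, if_neg ha, one_mul, if_pos (Finset.mem_insert_self _ _)]
          rfl
        · simp [fiberProj_kerSingle_of_ne hi, hi]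
  choose y hyD hy1 hy using key
  refine hD.mem_of_tendsto (f := y) (b := Filter.atTop) ?_ (Filter.Eventually.of_forall hyD)
  refine tendsto_subtype_rng.2 ?_
  refine Filter.Tendsto.prodMk_nhds ?_ (tendsto_pi_nhds.2 fun i => ?_)
  · refine tendsto_const_nhds.congr fun s => ?_
    exact (mem_ker.1 x.2).trans (hy1 s).symm
  · refine tendsto_const_nhds.congr' ?_
    filter_upwards [Filter.eventually_ge_atTop {i}] with s hs
    have := hy s i
    rw [if_pos (hs (Finset.mem_singleton_self i))] at this
    exact this.symm

end FiberProduct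

end ProfiniteCover

/-! ### Finite simple modules and their endomorphisms -/

namespace IsFiniteSimpleModule

variable {G G' A : Type u} [Group G] [TopologicalSpace G] [Group G'] [TopologicalSpace G']
  [AddCommGroup A]

theorem infl {π : G →ₜ* G'} (hπ : Function.Surjective π) {ρ : G' →* AddMonoid.End A}
    (h : IsFiniteSimpleModule ρ) : IsFiniteSimpleModule (inflModule π ρ) where
  finite := h.finite
  isOpen_stabilizer a := (h.isOpen_stabilizer a).preimage π.continuous_toFun
  nontrivial := h.nontrivial
  eq_bot_or_eq_top B hB := h.eq_bot_or_eq_top B fun g b hb => by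
    obtain ⟨g, rfl⟩ := hπ g
    exact hB g b hb

/-- Schur's lemma. -/
theorem isUnit_or_eq_zero {ρ : G →* AddMonoid.End A} (h : IsFiniteSimpleModule ρ)
    (α : endRing ρ) : IsUnit α ∨ α = 0 := by
  have := h.finite
  rcases h.eq_bot_or_eq_top (AddMonoidHom.ker α.1) (fun g b hb => by
    change α.1 (ρ g b) = 0
    rw [α.2 g b, (show α.1 b = 0 from hb), map_zero]) with hk | hk
  · left
    have hinj : Function.Injective α.1 := (AddMonoidHom.ker_eq_bot_iff _).1 hk
    let e : A ≃+ A := AddEquiv.ofBijective α.1 (Finite.injective_iff_bijective.1 hinj)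
    have he : ∀ a, α.1 (e.symm a) = a := e.apply_symm_apply
    have he' : ∀ a, e.symm (α.1 a) = a := e.symm_apply_apply
    let β : endRing ρ := ⟨e.symm.toAddMonoidHom, fun g a => by
      apply hinj
      change α.1 (e.symm (ρ g a)) = α.1 (ρ g (e.symm a))
      rw [α.2 g, he, he]⟩
    exact ⟨⟨α, β, Subtype.ext (AddMonoidHom.ext he), Subtype.ext (AddMonoidHom.ext he')⟩, rfl⟩
  · right
    refine Subtype.ext (AddMonoidHom.ext fun a => ?_)
    have : a ∈ AddMonoidHom.ker α.1 := by rw [hk]; trivial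
    exact this

theorem nontrivial_endRing {ρ : G →* AddMonoid.End A} (h : IsFiniteSimpleModule ρ) :
    Nontrivial (endRing ρ) := by
  have := h.nontrivial
  obtain ⟨a, ha⟩ := exists_ne (0 : A)
  exact ⟨1, 0, fun h => ha (congrArg (fun α : endRing ρ => α.1 a) h)⟩

end IsFiniteSimpleModule

/-- As π is onto, `G` and `G'` act through the same set of endomorphisms, which therefore have the
same commutant. This allows dimensions over the two rings to be compared. -/
theorem inflEnd_bijective {G G' A : Type u} [Group G] [TopologicalSpace G] [Group G']
    [TopologicalSpace G'] [AddCommGroup A] {π : G →ₜ* G'} (hπ : Function.Surjective π)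
    (ρ : G' →* AddMonoid.End A) : Function.Bijective (inflEnd π ρ) := by
  refine ⟨Subring.inclusion_injective _, fun α => ⟨⟨α.1, fun g a => ?_⟩, rfl⟩⟩
  obtain ⟨g, rfl⟩ := hπ g
  exact α.2 g a

/-! ### Equivariant homomorphisms from kernels to simple modules -/

namespace ProfiniteCover

variable {G G' A : Type u} [Group G] [TopologicalSpace G] [Group G'] [TopologicalSpace G']
  [AddCommGroup A]

theorem kerDual_map_one {p : ProfiniteCover G} {ρ : G →* AddMonoid.End A} (φ : p.kerDual ρ) :
    φ.1 1 = 0 := by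
  have := φ.2.2.1 1 1
  rwa [mul_one, left_eq_add] at this

theorem kerDual_map_mul {p : ProfiniteCover G} {ρ : G →* AddMonoid.End A} (φ : p.kerDual ρ)
    (x y : p.ker) : φ.1 (x * y) = φ.1 x + φ.1 y := φ.2.2.1 x y

theorem kerDual_map_inv {p : ProfiniteCover G} {ρ : G →* AddMonoid.End A} (φ : p.kerDual ρ)
    (x : p.ker) : φ.1 x⁻¹ = -φ.1 x := by
  have := kerDual_map_mul φ x x⁻¹
  rw [mul_inv_cancel, kerDual_map_one] at this
  exact (neg_eq_of_add_eq_zero_right this.symm).symm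

theorem kerDual_map_conj {p : ProfiniteCover G} {ρ : G →* AddMonoid.End A} (φ : p.kerDual ρ)
    (h : p.E) (x : p.ker) : φ.1 ⟨h * x * h⁻¹, p.conj_mem_ker h x⟩ = ρ (p.map h) (φ.1 x) :=
  φ.2.2.2 h x

/-- An equivariant homomorphism into a simple module that is nonzero is surjective. -/
theorem kerDual_surjective {p : ProfiniteCover G} {ρ : G →* AddMonoid.End A}
    (hρ : IsFiniteSimpleModule ρ) (φ : p.kerDual ρ) (hφ : φ ≠ 0) : Function.Surjective φ.1 := by
  let B : AddSubgroup A :=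
    { carrier := Set.range φ.1
      add_mem' := by
        rintro _ _ ⟨x, rfl⟩ ⟨y, rfl⟩
        exact ⟨x * y, kerDual_map_mul φ x y⟩
      zero_mem' := ⟨1, kerDual_map_one φ⟩
      neg_mem' := by
        rintro _ ⟨x, rfl⟩
        exact ⟨x⁻¹, kerDual_map_inv φ x⟩ }
  rcases hρ.eq_bot_or_eq_top B (by
    rintro g _ ⟨x, rfl⟩
    obtain ⟨h, rfl⟩ := p.surjective g
    exact ⟨_, kerDual_map_conj φ h x⟩) with h | h
  · refine absurd (Subtype.ext (funext fun x => ?_)) hφ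
    have : φ.1 x ∈ B := ⟨x, rfl⟩
    rwa [h] at this
  · intro a
    have : a ∈ B := by rw [h]; trivial
    exact this

theorem isClosed_kerDual_ker {p : ProfiniteCover G} [T2Space G] {ρ : G →* AddMonoid.End A}
    (φ : p.kerDual ρ) : IsClosed (Subtype.val '' {x : p.ker | φ.1 x = 0}) :=
  (p.isClosed_ker.isClosedEmbedding_subtypeVal.isClosedMap) _
    (φ.2.1.isClosed_fiber 0)

/-- The kernel of an equivariant homomorphism, as a normal subgroup of the cover. -/
def kerDualKer {p : ProfiniteCover G} {ρ : G →* AddMonoid.End A} (φ : p.kerDual ρ) :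
    Subgroup p.E where
  carrier := Subtype.val '' {x : p.ker | φ.1 x = 0}
  mul_mem' := by
    rintro _ _ ⟨x, hx, rfl⟩ ⟨y, hy, rfl⟩
    refine ⟨x * y, ?_, rfl⟩
    exact (kerDual_map_mul φ x y).trans (by rw [hx.out, hy.out, add_zero])
  one_mem' := ⟨1, kerDual_map_one φ, rfl⟩
  inv_mem' := by
    rintro _ ⟨x, hx, rfl⟩
    refine ⟨x⁻¹, ?_, rfl⟩
    exact (kerDual_map_inv φ x).trans (by rw [hx.out, neg_zero])

instance {p : ProfiniteCover G} {ρ : G →* AddMonoid.End A} (φ : p.kerDual ρ) :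
    (kerDualKer φ).Normal := ⟨by
  rintro _ ⟨x, hx, rfl⟩ h
  refine ⟨⟨h * x * h⁻¹, p.conj_mem_ker h x⟩, ?_, rfl⟩
  exact (kerDual_map_conj φ h x).trans (by rw [hx.out, map_zero])⟩

/-- An equivariant homomorphism from the kernel of an indecomposable cover into a simple module is
zero or an isomorphism. -/
theorem IsIndecomposable.eq_zero_or_bijective [T2Space G] {p : ProfiniteCover G}
    (hp : p.IsIndecomposable) {ρ : G →* AddMonoid.End A} (hρ : IsFiniteSimpleModule ρ)
    (φ : p.kerDual ρ) : φ = 0 ∨ Function.Bijective φ.1 := by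
  by_cases hφ : φ = 0
  · exact Or.inl hφ
  refine Or.inr ⟨fun x y hxy => ?_, kerDual_surjective hρ φ hφ⟩
  rcases hp.eq_bot_or_eq_ker (kerDualKer φ) (isClosed_kerDual_ker φ)
    (by rintro _ ⟨x, -, rfl⟩; exact x.2) with h | h
  · have : ((x⁻¹ * y : p.ker) : p.E) ∈ kerDualKer φ :=
      ⟨_, (kerDual_map_mul φ x⁻¹ y).trans (by rw [kerDual_map_inv, hxy, neg_add_cancel]), rfl⟩
    rw [h, Subgroup.mem_bot] at this
    exact inv_mul_eq_one.1 (Subtype.ext this)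
  · refine absurd (Subtype.ext (funext fun z => ?_)) hφ
    have : (z : p.E) ∈ kerDualKer φ := by rw [h]; exact z.2
    obtain ⟨w, hw, hwz⟩ := this
    rwa [← Subtype.ext hwz]

theorem kernelIso_of_bijective {p : ProfiniteCover G} {ρ : G →* AddMonoid.End A}
    (φ : p.kerDual ρ) (hφ : Function.Bijective φ.1) : p.KernelIso ρ :=
  ⟨Equiv.ofBijective _ hφ, kerDual_map_mul φ, kerDual_map_conj φ⟩

/-- `KernelIso` does not include continuity; it is automatic because the kernel is finite and
discrete. -/
theorem KernelIso.exists_bijective [T2Space G] {p : ProfiniteCover G} (hp : p.IsIndecomposable)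
    {ρ : G →* AddMonoid.End A} (h : p.KernelIso ρ) :
    ∃ φ : p.kerDual ρ, Function.Bijective φ.1 := by
  obtain ⟨e, h1, h2⟩ := h
  have := hp.discreteTopology_ker
  exact ⟨⟨e, IsLocallyConstant.of_discrete _, h1, h2⟩, e.bijective⟩

theorem KernelIso.not_hasNonabelianKernel {p : ProfiniteCover G} {ρ : G →* AddMonoid.End A}
    (h : p.KernelIso ρ) : ¬ p.HasNonabelianKernel := by
  rintro ⟨x, hx, y, hy, hxy⟩
  obtain ⟨e, h1, -⟩ := h
  refine hxy (congrArg Subtype.val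
    (e.injective (?_ : e (⟨x, hx⟩ * ⟨y, hy⟩) = e (⟨y, hy⟩ * ⟨x, hx⟩))))
  rw [h1, h1, add_comm]

/-- The kernel of an indecomposable cover is non-abelian or isomorphic to a finite simple
module. -/
theorem IsIndecomposable.exists_kernelIso [IsTopologicalGroup G] [CompactSpace G]
    [TotallyDisconnectedSpace G] {p : ProfiniteCover G} (hp : p.IsIndecomposable)
    (h : ¬ p.HasNonabelianKernel) : ∃ (A : Type u) (_ : AddCommGroup A)
      (ρ : G →* AddMonoid.End A), IsFiniteSimpleModule ρ ∧ p.KernelIso ρ := by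
  have hcomm : ∀ x y : p.ker, x * y = y * x := by
    intro x y
    by_contra hxy
    exact h ⟨x, x.2, y, y.2, fun h' => hxy (Subtype.ext h')⟩
  let _ : CommGroup p.ker := { (inferInstance : Group p.ker) with mul_comm := hcomm }
  have hfin := hp.finite_ker
  have hdisc := hp.discreteTopology_ker
  let c (x : p.E) : p.ker →* p.ker := (MulAut.conjNormal x).toMonoidHom
  -- As the kernel is commutative, conjugation depends only on the image in `G`. A set-theoretic
  -- section thus suffices to define the action of `G`.
  have hc : ∀ x y, p.map x = p.map y → c x = c y := by
    intro x y hxy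
    have hk : x⁻¹ * y ∈ p.ker := by rw [mem_ker, map_mul, map_inv, hxy, inv_mul_cancel]
    ext k
    have := congrArg Subtype.val (hcomm ⟨_, hk⟩ k)
    change x * k * x⁻¹ = y * k * y⁻¹
    change x⁻¹ * y * k = k * (x⁻¹ * y) at this
    rw [eq_mul_inv_iff_mul_eq]
    simpa [mul_assoc] using (congrArg (x * ·) this).symm
  let s : G → p.E := Function.surjInv p.surjective
  have hs : ∀ g, p.map (s g) = g := Function.surjInv_eq p.surjective
  have hcs : ∀ x, c (s (p.map x)) = c x := fun x => hc _ _ (hs _)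
  have hcmul : ∀ x y, c (x * y) = (c x).comp (c y) := fun x y => by
    ext k
    change x * y * k * (x * y)⁻¹ = x * (y * k * y⁻¹) * x⁻¹
    group
  let ρ : G →* AddMonoid.End (Additive p.ker) :=
    { toFun := fun g => (c (s g)).toAdditive
      map_one' := by
        rw [← map_one p.map, hcs]
        refine AddMonoidHom.ext fun k => Subtype.ext ?_
        change 1 * (k.toMul : p.E) * 1⁻¹ = k.toMul
        simp
      map_mul' := fun g h => by
        have : c (s (g * h)) = (c (s g)).comp (c (s h)) := by
          rw [← hcmul]; exact hc _ _ (by simp [hs])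
        rw [this]
        rfl }
  have hρ : ∀ (x : p.E) (k : Additive p.ker), ρ (p.map x) k = Additive.ofMul (c x k.toMul) :=
    fun x k => by
      change Additive.ofMul (c (s (p.map x)) k.toMul) = _
      rw [hcs]
  refine ⟨Additive p.ker, inferInstance, ρ, ⟨inferInstanceAs (Finite p.ker), fun a => ?_, ?_, ?_⟩,
    Additive.ofMul, fun _ _ => rfl, fun x k => (hρ x _).symm⟩
  -- The section `s` need not be continuous, so openness of the stabilizer is checked after pulling
  -- back to `p.E`, where the action is conjugation.
  · have hq : Topology.IsQuotientMap p.map :=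
      p.map.continuous_toFun.isClosedMap.isQuotientMap p.map.continuous_toFun p.surjective
    rw [← hq.isOpen_preimage]
    have hcont : Continuous fun x : p.E => c x a.toMul := Continuous.subtype_mk
      ((continuous_id.mul continuous_const).mul continuous_inv) _
    convert! (isOpen_discrete {a.toMul}).preimage hcont using 1
    ext x
    change ρ (p.map x) a = a ↔ c x a.toMul = a.toMul
    rw [hρ]
    rfl
  · obtain ⟨x, hx⟩ := hp.exists_ne_one
    exact ⟨Additive.ofMul x, 0, hx⟩
  · intro B hB
    -- A submodule is a finite, hence closed, normal subgroup of the cover, so minimality of the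
    -- kernel yields simplicity of the module.
    let N : Subgroup p.E := (AddSubgroup.toSubgroup' B).map p.ker.subtype
    have hN : N.Normal := ⟨by
      rintro _ ⟨k, hk, rfl⟩ x
      refine ⟨c x k, ?_, rfl⟩
      have := hB (p.map x) (Additive.ofMul k) hk
      rwa [hρ] at this⟩
    have hNfin : (N : Set p.E).Finite :=
      (Set.toFinite (AddSubgroup.toSubgroup' B : Set p.ker)).image _
    rcases hp.eq_bot_or_eq_ker N hNfin.isClosed (by rintro _ ⟨k, -, rfl⟩; exact k.2) with h | h
    · left
      rw [AddSubgroup.eq_bot_iff_forall]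
      intro b hb
      have : ((b.toMul : p.ker) : p.E) ∈ N := ⟨b.toMul, hb, rfl⟩
      rw [h, Subgroup.mem_bot] at this
      exact Subtype.ext this
    · right
      rw [AddSubgroup.eq_top_iff']
      intro b
      have : ((b.toMul : p.ker) : p.E) ∈ N := by rw [h]; exact b.toMul.2
      obtain ⟨k, hk, hkb⟩ := this
      have e : Additive.ofMul k = b := Subtype.ext hkb
      rw [← e]
      exact hk

end ProfiniteCover

/-! ### Linear algebra: lifting through `S` injectively -/

/-- A semilinear map `S' : V' → W` is the composition of an injective semilinear map with the linear
map `S : V → W` if its range is contained in that of `S` and the dimension of its kernel is at most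
that of the kernel of `S`. -/
theorem exists_injective_comp_eq {D' D V' V W : Type u} [Ring D'] [Ring D] [Nontrivial D']
    (hD : ∀ a : D', IsUnit a ∨ a = 0) [AddCommGroup V'] [AddCommGroup V] [AddCommGroup W]
    [Module D' V'] [Module D V] [Module D W] {σ : D' →+* D} (hσ : Function.Bijective σ)
    (S' : V' →ₛₗ[σ] W) (S : V →ₗ[D] W) (hr : Set.range S' ⊆ Set.range S)
    (hk : Module.rank D' (LinearMap.ker S') ≤ Module.rank D (LinearMap.ker S)) :
    ∃ T : V' →+ V, Function.Injective T ∧ (∀ (a : D') v, T (a • v) = σ a • T v) ∧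
      ∀ v, S (T v) = S' v := by
  -- Restricting scalars along σ makes every map linear over one division ring; as σ is bijective,
  -- the rank of `ker S` does not change.
  let _ : DivisionRing D' := DivisionRing.ofIsUnitOrEqZero hD
  let _ : Module D' V := Module.compHom V σ
  let _ : Module D' W := Module.compHom W σ
  let S₁ : V →ₗ[D'] W := { S with map_smul' := fun a v => S.map_smul (σ a) v }
  let S₁' : V' →ₗ[D'] W := { S' with map_smul' := fun a v => S'.map_smulₛₗ a v }
  have hk₁ : Module.rank D' (LinearMap.ker S₁') ≤ Module.rank D' (LinearMap.ker S₁) := by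
    refine hk.trans_eq (Eq.symm ?_)
    exact rank_eq_of_equiv_equiv σ
      (⟨⟨fun v => ⟨v.1, v.2⟩, fun v => ⟨v.1, v.2⟩, fun _ => rfl, fun _ => rfl⟩, fun _ _ => rfl⟩ :
        LinearMap.ker S₁ ≃+ LinearMap.ker S) hσ fun _ _ => rfl
  obtain ⟨ι, hι⟩ := Module.Free.exists_linearMap_injective_of_linearIndependent_of_rank_le
    (M := LinearMap.ker S₁')
    (Module.Basis.ofVectorSpace D' (LinearMap.ker S₁)).linearIndependent
    (by rw [(Module.Basis.ofVectorSpace D' (LinearMap.ker S₁)).mk_eq_rank'']; exact hk₁)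
  obtain ⟨s, hs⟩ := S₁.rangeRestrict.exists_rightInverse_of_surjective S₁.range_rangeRestrict
  obtain ⟨P, hP⟩ := (LinearMap.ker S₁').subtype.exists_leftInverse_of_injective
    (Submodule.ker_subtype _)
  have hr' : ∀ v, S₁' v ∈ LinearMap.range S₁ := fun v => hr ⟨v, rfl⟩
  let ℓ : V' →ₗ[D'] V := s.comp (S₁'.codRestrict _ hr')
  have hℓ : ∀ v, S₁ (ℓ v) = S₁' v := fun v =>
    congrArg Subtype.val (LinearMap.congr_fun hs ⟨S₁' v, hr' v⟩)
  let κ := LinearMap.ker S₁'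
  -- On the complement of `ker S'` cut out by `P`, lift `S'` through a section of `S`; on `ker S'`,
  -- use the embedding `ι` into `ker S` provided by the ranks.
  let T : V' →ₗ[D'] V :=
    ℓ.comp (LinearMap.id - κ.subtype.comp P) + (LinearMap.ker S₁).subtype.comp (ι.comp P)
  have hT : ∀ v, S₁ (T v) = S₁' v := fun v => by
    have h1 : S₁' (P v) = 0 := (P v).2
    have h2 : S₁ (ι (P v)) = 0 := (ι (P v)).2
    simp [T, hℓ, κ, h1, h2]
  refine ⟨T.toAddMonoidHom, ?_, fun a v => T.map_smul a v, hT⟩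
  refine (injective_iff_map_eq_zero T).2 fun v hv => ?_
  have hvk : v ∈ κ := by
    rw [LinearMap.mem_ker, ← hT, hv, map_zero]
  have hPv : P v = ⟨v, hvk⟩ := LinearMap.congr_fun hP ⟨v, hvk⟩
  have : T v = ι ⟨v, hvk⟩ := by simp [T, hPv, κ]
  rw [hv] at this
  have h0 : ι ⟨v, hvk⟩ = 0 := Subtype.ext this.symm
  exact congrArg Subtype.val ((injective_iff_map_eq_zero ι).1 hι _ h0)

/-! ### Extension classes and homomorphisms of covers -/

namespace ProfiniteCover

variable {G G' A : Type u} [Group G] [TopologicalSpace G] [Group G'] [TopologicalSpace G']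
  [AddCommGroup A]

/-- The pullback of an equivariant homomorphism along a homomorphism of covers. -/
def pullDual {π : G →ₜ* G'} {p : ProfiniteCover G} {q : ProfiniteCover G'} (f : p.E →ₜ* q.E)
    (hf : ∀ x, q.map (f x) = π (p.map x)) {ρ' : G' →* AddMonoid.End A}
    (ρ : G →* AddMonoid.End A) (hρ : ∀ g, ρ g = ρ' (π g)) (φ : q.kerDual ρ') : p.kerDual ρ :=
  ⟨fun x => φ.1 (kerMap f hf x), φ.2.1.comp_continuous (continuous_kerMap f hf),
    fun x y => by
      change φ.1 (kerMap f hf (x * y)) = _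
      rw [map_mul, kerDual_map_mul], fun h x => by
      have : kerMap f hf ⟨h * x * h⁻¹, p.conj_mem_ker h x⟩ =
          ⟨f h * kerMap f hf x * (f h)⁻¹, q.conj_mem_ker _ _⟩ := Subtype.ext (by
        change f (h * x * h⁻¹) = f h * f x * (f h)⁻¹
        simp)
      change φ.1 (kerMap f hf _) = ρ (p.map h) (φ.1 (kerMap f hf x))
      rw [this, kerDual_map_conj, hρ, hf]⟩

theorem pullDual_injective {π : G →ₜ* G'} {p : ProfiniteCover G} {q : ProfiniteCover G'}
    (f : p.E →ₜ* q.E) (hf : ∀ x, q.map (f x) = π (p.map x)) {ρ' : G' →* AddMonoid.End A}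
    (ρ : G →* AddMonoid.End A) (hρ : ∀ g, ρ g = ρ' (π g))
    (hs : Function.Surjective (kerMap f hf)) : Function.Injective (pullDual f hf ρ hρ) := by
  intro φ ψ h
  refine Subtype.ext (funext fun y => ?_)
  obtain ⟨x, rfl⟩ := hs y
  exact congrFun (congrArg Subtype.val h) x

variable [IsTopologicalGroup G] [CompactSpace G] [TotallyDisconnectedSpace G]

/-- Composing a continuous section of `p` with `f` gives a continuous section of `q` with the image
factor set, and the class does not depend on the section. -/
theorem transgression_pullDual {p q : ProfiniteCover G} (f : p.E →ₜ* q.E)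
    (hf : ∀ x, q.map (f x) = ContinuousMonoidHom.id G (p.map x)) (ρ : G →* AddMonoid.End A)
    (φ : q.kerDual ρ) :
    p.transgression ρ (pullDual f hf ρ (fun _ => rfl) φ) = q.transgression ρ φ := by
  have hu : ∀ g, q.map (f (p.contSection g)) = g := fun g => by
    rw [hf, map_contSection]; rfl
  rw [p.transgression_apply ρ _ p.continuous_contSection p.map_contSection,
    q.transgression_apply ρ _ (f.continuous_toFun.comp p.continuous_contSection) hu]
  congr 1
  refine Subtype.ext (funext fun σ => funext fun τ => congrArg φ.1 (Subtype.ext ?_))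
  change f (_ * _ * _⁻¹) = f _ * f _ * (f _)⁻¹
  simp

variable [IsTopologicalGroup G'] [CompactSpace G'] [TotallyDisconnectedSpace G']

/-- With sections `u` of `p` and `v` of `q`, both `f ∘ u` and `v ∘ π` lift π to `q`. They differ by
a cochain `d` with values in the kernel, and `φ ∘ d` bounds the difference of the two cocycles. -/
theorem inflH2_transgression {π : G →ₜ* G'} {p : ProfiniteCover G} {q : ProfiniteCover G'}
    (f : p.E →ₜ* q.E) (hf : ∀ x, q.map (f x) = π (p.map x)) (ρ' : G' →* AddMonoid.End A)
    (φ : q.kerDual ρ') : p.transgression (inflModule π ρ') (pullDual f hf _ (fun _ => rfl) φ) =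
      inflH2 π ρ' (q.transgression ρ' φ) := by
  have hu := p.map_contSection
  have hv := q.map_contSection
  have huc := p.continuous_contSection
  have hvc := q.continuous_contSection
  refine (Submodule.Quotient.eq _).2 ?_
  set u := p.contSection
  set v := q.contSection
  let d : G → q.ker := fun g => ⟨f (u g) * (v (π g))⁻¹, by simp [mem_ker, hf, hu, hv]⟩
  have hd : Continuous d := Continuous.subtype_mk
    ((f.continuous_toFun.comp huc).mul (hvc.comp π.continuous_toFun).inv) _
  refine ⟨fun g => φ.1 (d g), φ.2.1.comp_continuous hd, ?_⟩
  funext σ τ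
  have e1 := kerDual_map_conj φ (v (π σ)) (d τ)
  rw [hv] at e1
  have key : kerMap f hf (p.factorSet u hu σ τ) * d (σ * τ) =
      d σ * (⟨v (π σ) * d τ * (v (π σ))⁻¹, q.conj_mem_ker _ _⟩ : q.ker) *
        q.factorSet v hv (π σ) (π τ) := by
    apply Subtype.ext
    change f (u σ * u τ * (u (σ * τ))⁻¹) * (f (u (σ * τ)) * (v (π (σ * τ)))⁻¹) =
      f (u σ) * (v (π σ))⁻¹ * (v (π σ) * (f (u τ) * (v (π τ))⁻¹) * (v (π σ))⁻¹) *
        (v (π σ) * v (π τ) * (v (π σ * π τ))⁻¹)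
    simp only [map_mul, map_inv]
    group
  have e2 := congrArg φ.1 key
  simp only [kerDual_map_mul, e1] at e2
  change ρ' (π σ) (φ.1 (d τ)) - φ.1 (d (σ * τ)) + φ.1 (d σ) =
    φ.1 (kerMap f hf (p.factorSet u hu σ τ)) - φ.1 (q.factorSet v hv (π σ) (π τ))
  rw [eq_sub_of_add_eq e2]
  abel

/-- A cover whose kernel is isomorphic to a module `A` receives a homomorphism over `π` inducing
a given homomorphism into `A` on kernels if the cohomology classes agree. -/
theorem exists_hom_of_transgression_eq {π : G →ₜ* G'} {p : ProfiniteCover G}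
    {q : ProfiniteCover G'} {ρ' : G' →* AddMonoid.End A} (φ : q.kerDual ρ')
    (hφ : Function.Bijective φ.1) (ψ : p.kerDual (inflModule π ρ'))
    (h : p.transgression (inflModule π ρ') ψ = inflH2 π ρ' (q.transgression ρ' φ)) :
    ∃ (f : p.E →ₜ* q.E) (hf : ∀ x, q.map (f x) = π (p.map x)),
      ∀ k, φ.1 (kerMap f hf k) = ψ.1 k := by
  have hu := p.map_contSection
  have hv := q.map_contSection
  have huc := p.continuous_contSection
  have hvc := q.continuous_contSection
  obtain ⟨c, hcc, hc⟩ := (Submodule.Quotient.eq _).1 h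
  set u := p.contSection
  set v := q.contSection
  replace hc : ∀ σ τ, ρ' (π σ) (c τ) - c (σ * τ) + c σ =
      ψ.1 (p.factorSet u hu σ τ) - φ.1 (q.factorSet v hv (π σ) (π τ)) := fun σ τ =>
    congrFun (congrFun hc σ) τ
  let e := Equiv.ofBijective _ hφ
  have he : ∀ a, φ.1 (e.symm a) = a := e.apply_symm_apply
  let r : p.E → p.ker := fun x => ⟨x * (u (p.map x))⁻¹, by simp [mem_ker, hu]⟩
  have hr : Continuous r :=
    (continuous_id.mul (huc.comp p.map.continuous_toFun).inv).subtype_mk _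
  -- Write `x = r x * u (p.map x)`. The image of `x` is to be `v (π (p.map x))` preceded by a kernel
  -- factor whose value under `φ` is `m x`; the term `c` corrects for the two cocycles being only
  -- cohomologous. `hmul` is multiplicativity in these coordinates.
  let m : p.E → A := fun x => ψ.1 (r x) + c (p.map x)
  have hm : IsLocallyConstant m :=
    (ψ.2.1.comp_continuous hr).add (IsLocallyConstant.comp_continuous hcc p.map.continuous_toFun)
  have hmul : ∀ x y, m (x * y) =
      m x + ρ' (π (p.map x)) (m y) + φ.1 (q.factorSet v hv (π (p.map x)) (π (p.map y))) := by
    intro x y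
    have h1 : r (x * y) = r x * (⟨u (p.map x) * r y * (u (p.map x))⁻¹, p.conj_mem_ker _ _⟩ : p.ker)
        * p.factorSet u hu (p.map x) (p.map y) := by
      apply Subtype.ext
      change x * y * (u (p.map (x * y)))⁻¹ = x * (u (p.map x))⁻¹ *
        (u (p.map x) * (y * (u (p.map y))⁻¹) * (u (p.map x))⁻¹) *
        (u (p.map x) * u (p.map y) * (u (p.map x * p.map y))⁻¹)
      rw [map_mul]
      group
    have h2 := hc (p.map x) (p.map y)
    have h3 := kerDual_map_conj ψ (u (p.map x)) (r y)
    rw [hu] at h3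
    change ψ.1 (r (x * y)) + c (p.map (x * y)) = _
    rw [h1, kerDual_map_mul, kerDual_map_mul, h3, map_mul]
    change ψ.1 (r x) + ρ' (π (p.map x)) (ψ.1 (r y)) + _ + _ =
      ψ.1 (r x) + c (p.map x) + ρ' (π (p.map x)) (ψ.1 (r y) + c (p.map y)) + _
    rw [map_add, ← sub_eq_iff_eq_add.2 (sub_eq_iff_eq_add'.1 h2.symm)]
    abel
  let F : p.E → q.E := fun x => e.symm (m x) * v (π (p.map x))
  have hFq : ∀ x, q.map (F x) = π (p.map x) := fun x => by
    change q.map (_ * _) = _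
    rw [map_mul, mem_ker.1 (e.symm (m x)).2, one_mul, hv]
  have hFmul : ∀ x y, F (x * y) = F x * F y := by
    intro x y
    have h1 : e.symm (m (x * y)) = e.symm (m x) *
        (⟨v (π (p.map x)) * e.symm (m y) * (v (π (p.map x)))⁻¹, q.conj_mem_ker _ _⟩ : q.ker) *
        q.factorSet v hv (π (p.map x)) (π (p.map y)) := by
      apply hφ.1
      rw [he, kerDual_map_mul, kerDual_map_mul, kerDual_map_conj, he, he, hv, hmul]
    change (e.symm (m (x * y)) : q.E) * v (π (p.map (x * y))) = _
    rw [h1]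
    change (e.symm (m x) : q.E) * (v (π (p.map x)) * e.symm (m y) * (v (π (p.map x)))⁻¹) *
      (v (π (p.map x)) * v (π (p.map y)) * (v (π (p.map x) * π (p.map y)))⁻¹) *
      v (π (p.map (x * y))) =
      (e.symm (m x) * v (π (p.map x))) * (e.symm (m y) * v (π (p.map y)))
    rw [map_mul, map_mul]
    group
  let f : p.E →ₜ* q.E :=
    { toMonoidHom := MonoidHom.mk' F hFmul
      continuous_toFun := by
        have h1 : Continuous fun x => ((e.symm (m x) : q.ker) : q.E) :=
          (hm.comp fun a => ((e.symm a : q.ker) : q.E)).continuous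
        exact h1.mul (hvc.comp (π.continuous_toFun.comp p.map.continuous_toFun)) }
  refine ⟨f, hFq, fun k => ?_⟩
  have hk : p.map k = 1 := k.2
  have hu1 : p.map (u 1) = 1 := hu 1
  have hv1 : q.map (v 1) = 1 := hv 1
  have h1 : kerMap (π := π) f hFq k = e.symm (m k) * ⟨v 1, hv1⟩ := Subtype.ext (by
    change (e.symm (m k) : q.E) * v (π (p.map k)) = e.symm (m k) * v 1
    rw [hk, map_one])
  have h2 : r k = k * (⟨u 1, hu1⟩ : p.ker)⁻¹ := Subtype.ext (by
    change (k : p.E) * (u (p.map k))⁻¹ = k * (u 1)⁻¹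
    rw [hk])
  -- The sections are not normalized at `1`. The coboundary relation at `(1, 1)` gives `c 1 = ψ (u
  -- 1) - φ (v 1)`, which cancels the resulting error terms.
  have h3 := hc 1 1
  have h4 : p.factorSet u hu 1 1 = ⟨u 1, hu1⟩ := Subtype.ext (by simp [factorSet])
  have h5 : q.factorSet v hv (π 1) (π 1) = ⟨v 1, hv1⟩ := Subtype.ext (by simp [factorSet])
  rw [h4, h5, mul_one, map_one π, map_one ρ', AddMonoid.End.coe_one, id, sub_self, zero_add] at h3
  rw [h1, kerDual_map_mul, he]
  change ψ.1 (r k) + c (p.map k) + _ = _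
  rw [hk, h3, h2, kerDual_map_mul, kerDual_map_inv]
  abel

end ProfiniteCover

/-! ### Necessity of the two conditions -/

namespace ProfiniteCover

variable {G G' A : Type u} [Group G] [TopologicalSpace G] [Group G'] [TopologicalSpace G']
  [AddCommGroup A]
  [IsTopologicalGroup G] [CompactSpace G] [TotallyDisconnectedSpace G]
  [IsTopologicalGroup G'] [CompactSpace G'] [TotallyDisconnectedSpace G']
  {I I' : Type u} {η : I → ProfiniteCover G} {η' : I' → ProfiniteCover G'}

theorem conj_kerSingle {i : I} (x : (fiberProduct η).E) (k : (η i).ker) :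
    (⟨x * kerSingle i k * x⁻¹, (fiberProduct η).conj_mem_ker _ _⟩ : (fiberProduct η).ker) =
      kerSingle i ⟨fiberProj η i x * (k : (η i).E) * (fiberProj η i x)⁻¹,
        (η i).conj_mem_ker _ _⟩ := by
  refine Subtype.ext (fiberProduct_ext ?_ fun l => ?_)
  · exact (mem_ker.1 ((fiberProduct η).conj_mem_ker x (kerSingle i k))).trans
      (kerSingle i _).2.symm
  · change fiberProj η l (x * kerSingle i k * x⁻¹) = _
    rw [map_mul, map_mul, map_inv]
    by_cases h : l = i
    · subst h
      rw [fiberProj_kerSingle_self, fiberProj_kerSingle_self]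
    · rw [fiberProj_kerSingle_of_ne h, fiberProj_kerSingle_of_ne h]
      simp

/-- The restriction of an equivariant homomorphism to a factor of a fiber product. -/
noncomputable def singleDual {ρ : G →* AddMonoid.End A} {i : I} (hi : (η i).IsIndecomposable)
    (ψ : (fiberProduct η).kerDual ρ) : (η i).kerDual ρ :=
  ⟨fun k => ψ.1 (kerSingle i k),
    have := hi.discreteTopology_ker
    IsLocallyConstant.of_discrete _,
    fun x y => by
      change ψ.1 (kerSingle i (x * y)) = _
      rw [map_mul, kerDual_map_mul], fun h k => by
      obtain ⟨x, rfl⟩ := fiberProj_surjective i h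
      change ψ.1 (kerSingle i _) = _
      rw [← conj_kerSingle, kerDual_map_conj, map_fiberProj]⟩

/-- By continuity the zeros of `ψ` form a closed subgroup, so vanishing can be tested on the single
components of `x`. -/
theorem kerDual_eq_zero_of_kerSingle {ρ : G →* AddMonoid.End A}
    (ψ : (fiberProduct η).kerDual ρ) (x : (fiberProduct η).ker)
    (h : ∀ i, ψ.1 (kerSingle i (kerProj i x)) = 0) : ψ.1 x = 0 := by
  have : (x : (fiberProduct η).E) ∈ kerDualKer ψ :=
    mem_of_kerSingle_mem _ (isClosed_kerDual_ker ψ) x fun i => ⟨_, h i, rfl⟩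
  obtain ⟨y, hy, hyx⟩ := this
  rwa [← Subtype.ext hyx]

/-- The projection of the fiber product onto its `A`-isotypic part. -/
def toIsotypic (η : I → ProfiniteCover G) (ρ : G →* AddMonoid.End A) :
    (fiberProduct η).E →ₜ* (isotypicFiberProduct η ρ).E :=
  fiberLift (fiberProduct η).map (fun i => fiberProj η i) fun i => map_fiberProj i.1

theorem map_toIsotypic (ρ : G →* AddMonoid.End A) (x : (fiberProduct η).E) :
    (isotypicFiberProduct η ρ).map (toIsotypic η ρ x) =
      ContinuousMonoidHom.id G ((fiberProduct η).map x) := rfl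

theorem kerMap_toIsotypic_surjective (ρ : G →* AddMonoid.End A) :
    Function.Surjective (kerMap (toIsotypic η ρ) (map_toIsotypic ρ)) := by
  classical
  rintro ⟨⟨⟨g, y⟩, hy⟩, hg⟩
  obtain rfl : g = 1 := hg
  refine ⟨⟨⟨(1, fun i => if h : (η i).KernelIso ρ then y ⟨i, h⟩ else 1), fun i => ?_⟩, rfl⟩, ?_⟩
  · change (η i).map (if h : (η i).KernelIso ρ then y ⟨i, h⟩ else 1) = 1
    by_cases h : (η i).KernelIso ρ
    · rw [dif_pos h]; exact hy ⟨i, h⟩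
    · rw [dif_neg h, map_one]
  · refine Subtype.ext (fiberProduct_ext rfl fun i => ?_)
    exact dif_pos i.2

omit [CompactSpace G] in
/-- An equivariant homomorphism that is trivial on the kernel of an epimorphism of covers factors
through it. -/
theorem exists_pullDual_eq {p q : ProfiniteCover G} (f : p.E →ₜ* q.E)
    (hf : ∀ x, q.map (f x) = ContinuousMonoidHom.id G (p.map x))
    (hs : Function.Surjective (kerMap f hf)) (ρ : G →* AddMonoid.End A) (ψ : p.kerDual ρ)
    (h : ∀ k, kerMap f hf k = 1 → ψ.1 k = 0) :
    ∃ φ : q.kerDual ρ, pullDual f hf ρ (fun _ => rfl) φ = ψ := by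
  have hfs : Function.Surjective f := surjective_of_kerMap Function.surjective_id f hf hs
  have hwd : ∀ x y, kerMap f hf x = kerMap f hf y → ψ.1 x = ψ.1 y := fun x y hxy => by
    have := h (x⁻¹ * y) (by rw [map_mul, map_inv, hxy, inv_mul_cancel])
    rw [kerDual_map_mul, kerDual_map_inv, neg_add_eq_zero] at this
    exact this
  let s := Function.surjInv hs
  have hsf : ∀ y, kerMap f hf (s y) = y := Function.surjInv_eq hs
  have hsψ : ∀ x, ψ.1 (s (kerMap f hf x)) = ψ.1 x := fun x => hwd _ _ (hsf _)
  have hcont := continuous_kerMap f hf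
  refine ⟨⟨fun y => ψ.1 (s y), fun t => ?_, fun x y => ?_, fun z y => ?_⟩,
    Subtype.ext (funext hsψ)⟩
  · rw [← (hcont.isClosedMap.isQuotientMap hcont hs).isOpen_preimage]
    convert! ψ.2.1 t using 1
    ext x
    change ψ.1 (s (kerMap f hf x)) ∈ t ↔ _
    rw [hsψ]
    rfl
  · change ψ.1 (s (x * y)) = ψ.1 (s x) + ψ.1 (s y)
    rw [← kerDual_map_mul]
    exact hwd _ _ (by rw [map_mul, hsf, hsf, hsf])
  · obtain ⟨x, rfl⟩ := hfs z
    change ψ.1 (s _) = ρ _ (ψ.1 (s y))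
    rw [hf]
    change _ = ρ (p.map x) (ψ.1 (s y))
    rw [← kerDual_map_conj]
    refine hwd _ _ ?_
    rw [hsf]
    apply Subtype.ext
    change f x * y * (f x)⁻¹ = f (x * s y * x⁻¹)
    rw [map_mul, map_mul, map_inv, (show f (s y) = y from congrArg Subtype.val (hsf y))]

/-- `V` is the space of equivariant homomorphisms from the kernel of the full fiber product. -/
theorem pullDual_toIsotypic_bijective (hη : ∀ i, (η i).IsIndecomposable)
    {ρ : G →* AddMonoid.End A} (hρ : IsFiniteSimpleModule ρ) :
    Function.Bijective (pullDual (toIsotypic η ρ) (map_toIsotypic ρ) ρ (fun _ => rfl)) := by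
  refine ⟨pullDual_injective _ _ _ _ (kerMap_toIsotypic_surjective ρ), fun ψ => ?_⟩
  refine exists_pullDual_eq _ _ (kerMap_toIsotypic_surjective ρ) ρ ψ fun x hx => ?_
  refine kerDual_eq_zero_of_kerSingle ψ x fun i => ?_
  -- A factor on which `ψ` does not vanish has kernel isomorphic to the module, so its component is
  -- seen by the isotypic part.
  rcases (hη i).eq_zero_or_bijective hρ (singleDual (hη i) ψ) with h | h
  · exact congrFun (congrArg Subtype.val h) _
  · have : kerProj i x = 1 := Subtype.ext (congrArg (fun y : (isotypicFiberProduct η ρ).ker =>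
      fiberProj _ ⟨i, kernelIso_of_bijective _ h⟩ y.1) hx)
    rw [this, map_one, kerDual_map_one]

/-- An epimorphism of fiber products over `π` embeds the kernel and the image of the inflation
of `S'` in those of `S`. -/
theorem range_subset_and_rank_le {π : G →ₜ* G'} (hπ : Function.Surjective π)
    (hη : ∀ i, (η i).IsIndecomposable) (θ : (fiberProduct η).E →ₜ* (fiberProduct η').E)
    (hθ : ∀ x, (fiberProduct η').map (θ x) = π ((fiberProduct η).map x))
    (hs : Function.Surjective (kerMap θ hθ)) {ρ' : G' →* AddMonoid.End A}
    (hρ' : IsFiniteSimpleModule ρ') :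
    Set.range ((inflH2 π ρ').comp (S η' ρ')) ⊆ Set.range (S η (inflModule π ρ')) ∧
      Module.rank (endRing ρ') (LinearMap.ker ((inflH2 π ρ').comp (S η' ρ'))) ≤
        Module.rank (endRing (inflModule π ρ')) (LinearMap.ker (S η (inflModule π ρ'))) := by
  let R : V η (inflModule π ρ') → (fiberProduct η).kerDual (inflModule π ρ') :=
    pullDual (toIsotypic η (inflModule π ρ')) (map_toIsotypic _) _ (fun _ => rfl)
  have hR : Function.Bijective R := pullDual_toIsotypic_bijective hη (hρ'.infl hπ)
  let R' : V η' ρ' → (fiberProduct η').kerDual ρ' :=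
    pullDual (toIsotypic η' ρ') (map_toIsotypic ρ') ρ' (fun _ => rfl)
  let Θ := pullDual θ hθ (ρ' := ρ') (inflModule π ρ') (fun _ => rfl)
  have hΘ : Function.Injective Θ := pullDual_injective _ _ _ _ hs
  have hR' : Function.Injective R' :=
    pullDual_injective _ _ _ _ (kerMap_toIsotypic_surjective ρ')
  have hinj : Function.Injective fun φ => Θ (R' φ) := hΘ.comp hR'
  -- `j` is `R⁻¹ ∘ Θ ∘ R'`. Its additivity and semilinearity are read off after applying the
  -- injective map `R`.
  choose j hj using fun φ : V η' ρ' => hR.2 (Θ (R' φ))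
  have hjS : ∀ φ, S η (inflModule π ρ') (j φ) = inflH2 π ρ' (S η' ρ' φ) := fun φ => by
    have h1 := transgression_pullDual (toIsotypic η _) (map_toIsotypic _) (inflModule π ρ') (j φ)
    have h2 := inflH2_transgression θ hθ ρ' (R' φ)
    have h3 := transgression_pullDual (toIsotypic η' _) (map_toIsotypic _) ρ' φ
    have h4 : pullDual (toIsotypic η (inflModule π ρ')) (map_toIsotypic _) _ (fun _ => rfl) (j φ) =
      pullDual θ hθ (ρ' := ρ') (inflModule π ρ') (fun _ => rfl) (R' φ) := hj φ
    have h5 : (fiberProduct η').transgression ρ' (R' φ) = S η' ρ' φ := h3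
    rw [h4, h2, h5] at h1
    exact h1.symm
  have hjinj : Function.Injective j := fun φ ψ h => hinj (by
    change Θ (R' φ) = Θ (R' ψ)
    rw [← hj, ← hj, h])
  have hjadd : ∀ φ ψ, j (φ + ψ) = j φ + j ψ := fun φ ψ => hR.1 (by
    rw [hj]
    change Θ (R' φ) + Θ (R' ψ) = R (j φ) + R (j ψ)
    rw [hj, hj])
  have hjsmul : ∀ (α : endRing ρ') φ, j (α • φ) = inflEnd π ρ' α • j φ := fun α φ => hR.1 (by
    rw [hj]
    change inflEnd π ρ' α • Θ (R' φ) = inflEnd π ρ' α • R (j φ)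
    rw [hj])
  refine ⟨?_, ?_⟩
  · rintro _ ⟨φ, rfl⟩
    exact ⟨j φ, hjS φ⟩
  · let jk (φ : LinearMap.ker ((inflH2 π ρ').comp (S η' ρ'))) :
        LinearMap.ker (S η (inflModule π ρ')) := ⟨j φ.1, (hjS φ.1).trans φ.2⟩
    refine rank_le_of_surjective_injective (inflEnd π ρ')
      (AddMonoidHom.mk' jk fun φ ψ => Subtype.ext (hjadd φ.1 ψ.1)) (inflEnd_bijective hπ ρ').2 ?_ ?_
    · exact fun φ ψ h => Subtype.ext (hjinj (congrArg Subtype.val h))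
    · exact fun α φ => Subtype.ext (hjsmul α φ.1)

omit [CompactSpace G'] in
/-- An epimorphism over `π` from a fiber product onto a cover with minimal non-abelian kernel
factors through one of the projections. -/
theorem exists_factor_fiberProj {π : G →ₜ* G'} (hπ : Function.Surjective π)
    (hη : ∀ i, (η i).IsIndecomposable) {q : ProfiniteCover G'} (hq : q.IsIndecomposable)
    (hqn : q.HasNonabelianKernel) (f : (fiberProduct η).E →ₜ* q.E)
    (hf : ∀ x, q.map (f x) = π ((fiberProduct η).map x))
    (hs : Function.Surjective (kerMap f hf)) :
    ∃ (i : I) (c : (η i).E →ₜ* q.E) (hc : ∀ x, q.map (c x) = π ((η i).map x)),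
      Function.Bijective (kerMap c hc) ∧ ∀ x, c (fiberProj η i x) = f x := by
  have hfs := surjective_of_kerMap hπ f hf hs
  -- Each factor of the kernel is a finite normal subgroup of the fiber product, so its image in the
  -- minimal kernel of `q` is trivial or everything.
  have hdich : ∀ i, (∀ k, kerMap f hf (kerSingle (η := η) i k) = 1) ∨
      ∀ y, ∃ k, kerMap f hf (kerSingle (η := η) i k) = y := by
    intro i
    let M : Subgroup (fiberProduct η).E :=
      ((kerSingle (η := η) i).range).map (fiberProduct η).ker.subtype
    have hM : M.Normal := ⟨by
      rintro _ ⟨_, ⟨k, rfl⟩, rfl⟩ x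
      exact ⟨_, ⟨_, (conj_kerSingle x k).symm⟩, rfl⟩⟩
    have := (hη i).finite_ker
    have hMf : (M : Set (fiberProduct η).E).Finite :=
      (Set.finite_range (kerSingle (η := η) i)).image _
    rcases hq.eq_one_or_exists f hfs M hMf.isClosed (by
      rintro _ ⟨x, -, rfl⟩
      exact (kerMap f hf x).2) with h | h
    · left
      exact fun k => Subtype.ext (h _ ⟨_, ⟨k, rfl⟩, rfl⟩)
    · right
      intro y
      obtain ⟨_, ⟨_, ⟨k, rfl⟩, rfl⟩, hk⟩ := h y y.2
      exact ⟨k, Subtype.ext hk⟩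
  have hcl : IsClosed (f.toMonoidHom.ker : Set (fiberProduct η).E) :=
    isClosed_singleton.preimage f.continuous_toFun
  have hne : ∃ i, ∀ y, ∃ k, kerMap f hf (kerSingle (η := η) i k) = y := by
    by_contra hcon
    rw [not_exists] at hcon
    obtain ⟨y, hy⟩ := hq.exists_ne_one
    obtain ⟨x, rfl⟩ := hs y
    refine hy (Subtype.ext ?_)
    exact mem_of_kerSingle_mem f.toMonoidHom.ker hcl x fun i =>
      congrArg Subtype.val ((hdich i).resolve_right (hcon i) (kerProj i x))
  obtain ⟨i, hi⟩ := hne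
  -- Distinct factors commute elementwise; if two of them mapped onto `q.ker`, it would be abelian.
  have hother : ∀ l ≠ i, ∀ k, kerMap f hf (kerSingle (η := η) l k) = 1 := by
    intro l hl
    refine (hdich l).resolve_right fun hl' => ?_
    obtain ⟨x, hx, y, hy, hxy⟩ := hqn
    obtain ⟨a, ha⟩ := hi ⟨x, hx⟩
    obtain ⟨b, hb⟩ := hl' ⟨y, hy⟩
    refine hxy (congrArg Subtype.val (?_ : (⟨x, hx⟩ : q.ker) * ⟨y, hy⟩ = ⟨y, hy⟩ * ⟨x, hx⟩))
    rw [← ha, ← hb, ← map_mul, ← map_mul]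
    congr 1
    refine Subtype.ext (fiberProduct_ext ?_ fun m => ?_)
    · exact (mem_ker.1 (kerSingle i a * kerSingle l b).2).trans
        (mem_ker.1 (kerSingle l b * kerSingle i a).2).symm
    · change fiberProj η m (_ * _) = fiberProj η m (_ * _)
      rw [map_mul, map_mul]
      by_cases hm : m = i
      · rw [fiberProj_kerSingle_of_ne (by rw [hm]; exact hl.symm) b]; simp
      · rw [fiberProj_kerSingle_of_ne hm]; simp
  have hker : ∀ x, fiberProj η i x = 1 → f x = 1 := by
    intro x hx
    have hx1 : (fiberProduct η).map x = 1 := by rw [← map_fiberProj i, hx, map_one]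
    refine mem_of_kerSingle_mem f.toMonoidHom.ker hcl ⟨x, hx1⟩ fun l => ?_
    by_cases hl : l = i
    · subst hl
      have : kerProj l ⟨x, hx1⟩ = 1 := Subtype.ext hx
      rw [this, map_one]
      exact Subgroup.one_mem _
    · exact congrArg Subtype.val (hother l hl _)
  obtain ⟨c, hc⟩ := exists_comp_eq (fiberProj η i) (fiberProj_surjective i) f hker
  have hcq : ∀ x, q.map (c x) = π ((η i).map x) := fun x => by
    obtain ⟨x, rfl⟩ := fiberProj_surjective i x
    rw [hc, hf, map_fiberProj]
  have hck : ∀ k, kerMap c hcq k = kerMap f hf (kerSingle i k) := fun k => Subtype.ext (by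
    change c k = f (kerSingle i k)
    rw [← hc, fiberProj_kerSingle_self])
  have hcsurj : Function.Surjective (kerMap c hcq) := fun y => by
    obtain ⟨k, hk⟩ := hi y
    exact ⟨k, (hck k).trans hk⟩
  refine ⟨i, c, hcq, ⟨?_, hcsurj⟩, hc⟩
  -- The kernel of `c` within the minimal kernel of `η i` is trivial or everything; the latter is
  -- excluded because `q.ker` is non-trivial.
  let N : Subgroup (η i).E := (η i).ker ⊓ c.toMonoidHom.ker
  have hNcl : IsClosed (N : Set (η i).E) :=
    (η i).isClosed_ker.inter (isClosed_singleton.preimage c.continuous_toFun)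
  have hNn : N.Normal := Subgroup.normal_inf_normal _ _
  refine (injective_iff_map_eq_one _).2 fun k hk => ?_
  have hkN : (k : (η i).E) ∈ N := ⟨k.2, congrArg Subtype.val hk⟩
  rcases (hη i).eq_bot_or_eq_ker N hNcl inf_le_left with h | h
  · rw [h] at hkN
    exact Subtype.ext hkN
  · exfalso
    obtain ⟨y, hy⟩ := hq.exists_ne_one
    obtain ⟨k', rfl⟩ := hcsurj y
    have : (k' : (η i).E) ∈ N := by rw [h]; exact k'.2
    exact hy (Subtype.ext this.2)

omit [IsTopologicalGroup G] [CompactSpace G] [TotallyDisconnectedSpace G] in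
theorem iso_of_bijective {p q : ProfiniteCover G} (f : p.E →ₜ* q.E)
    (hf : ∀ x, q.map (f x) = p.map x) (hb : Function.Bijective f) : p.Iso q :=
  ⟨{ MulEquiv.ofBijective f hb with
      continuous_toFun := f.continuous_toFun
      continuous_invFun :=
        (f.continuous_toFun.homeoOfEquivCompactToT2
          (f := Equiv.ofBijective f hb)).continuous_symm },
    hf⟩

omit [CompactSpace G'] in
/-- A homomorphism over `π` that is an isomorphism on kernels identifies its domain with an
inflation. -/
theorem iso_infl_of_bijective {π : G →ₜ* G'} {p : ProfiniteCover G} {q : ProfiniteCover G'}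
    (c : p.E →ₜ* q.E) (hc : ∀ x, q.map (c x) = π (p.map x))
    (hb : Function.Bijective (kerMap c hc)) : p.Iso (infl π q) := by
  let f : p.E →ₜ* (infl π q).E :=
    { toFun := fun x => ⟨(p.map x, c x), hc x⟩
      map_one' := Subtype.ext (Prod.ext (map_one p.map) (map_one c))
      map_mul' := fun x y => Subtype.ext (Prod.ext (map_mul p.map x y) (map_mul c x y))
      continuous_toFun := (p.map.continuous_toFun.prodMk c.continuous_toFun).subtype_mk _ }
  refine iso_of_bijective f (fun _ => rfl) ⟨(injective_iff_map_eq_one f).2 fun x hx => ?_, ?_⟩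
  · have h1 : p.map x = 1 := congrArg (fun y : (infl π q).E => y.1.1) hx
    have h2 : c x = 1 := congrArg (fun y : (infl π q).E => y.1.2) hx
    have := (injective_iff_map_eq_one _).1 hb.1 ⟨x, h1⟩ (Subtype.ext h2)
    exact congrArg Subtype.val this
  · rintro ⟨⟨g, y⟩, hy⟩
    obtain ⟨x, rfl⟩ := p.surjective g
    have hy : q.map y = π (p.map x) := hy
    obtain ⟨k, hk⟩ := hb.2 ⟨(c x)⁻¹ * y, by rw [mem_ker, map_mul, map_inv, hc, hy, inv_mul_cancel]⟩
    have hk' : c k = (c x)⁻¹ * y := congrArg Subtype.val hk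
    refine ⟨x * k, Subtype.ext (Prod.ext ?_ ?_)⟩
    · change p.map (x * k) = p.map x
      rw [map_mul, mem_ker.1 k.2, mul_one]
    · change c (x * k) = y
      rw [map_mul, hk', mul_inv_cancel_left]

/-- Each `j` with `η' j` isomorphic to `ζ'` yields a map onto `ζ'` that factors through some `η (i
j)`, which is then the inflation of `ζ'`. It remains to see that `j` is determined by `i j`. -/
theorem mk_iso_le {π : G →ₜ* G'} (hπ : Function.Surjective π)
    (hη : ∀ i, (η i).IsIndecomposable) (θ : (fiberProduct η).E →ₜ* (fiberProduct η').E)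
    (hθ : ∀ x, (fiberProduct η').map (θ x) = π ((fiberProduct η).map x))
    (hs : Function.Surjective (kerMap θ hθ)) {ζ' : ProfiniteCover G'} (hζ : ζ'.IsIndecomposable)
    (hζn : ζ'.HasNonabelianKernel) :
    Cardinal.mk {i : I' // (η' i).Iso ζ'} ≤ Cardinal.mk {i : I // (η i).Iso (infl π ζ')} := by
  choose e he using fun j : {i : I' // (η' i).Iso ζ'} => j.2
  let f (j : {i : I' // (η' i).Iso ζ'}) : (fiberProduct η).E →ₜ* ζ'.E :=
    ((e j : (η' j).E →ₜ* ζ'.E).comp (fiberProj η' j)).comp θ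
  have hf' : ∀ j x, f j x = e j (fiberProj η' j (θ x)) := fun _ _ => rfl
  have hf : ∀ j x, ζ'.map (f j x) = π ((fiberProduct η).map x) := fun j x => by
    rw [hf', he, map_fiberProj, hθ]
  have hfs : ∀ j, Function.Surjective (kerMap (f j) (hf j)) := by
    intro j y
    have hy : (e j).symm y ∈ (η' j).ker := by
      rw [mem_ker, ← he, ContinuousMulEquiv.apply_symm_apply]; exact y.2
    obtain ⟨x, hx⟩ := hs (kerSingle j.1 ⟨_, hy⟩)
    refine ⟨x, Subtype.ext ?_⟩
    change e j (fiberProj η' j (θ x)) = y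
    rw [(show θ x = _ from congrArg Subtype.val hx), fiberProj_kerSingle_self]
    exact (e j).apply_symm_apply _
  choose i c hc hb hcf using fun j => exists_factor_fiberProj hπ hη hζ hζn (f j) (hf j) (hfs j)
  refine Cardinal.mk_le_of_injective
    (f := fun j => ⟨i j, iso_infl_of_bijective (c j) (hc j) (hb j)⟩) fun j l hjl => ?_
  have hijl : i j = i l := congrArg Subtype.val hjl
  by_contra hne
  have hne' : j.1 ≠ l.1 := fun h => hne (Subtype.ext h)
  obtain ⟨y, hy⟩ := hζ.exists_ne_one
  have hy' : (e j).symm y ∈ (η' j).ker := by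
    rw [mem_ker, ← he, ContinuousMulEquiv.apply_symm_apply]; exact y.2
  -- θ sends `x` into the `j`-th factor, so `f l` kills `x` and `f j` does not. If `i j = i l`,
  -- injectivity of `c l` on the kernel makes the common component of `x` trivial, whence `f j x =
  -- 1`.
  obtain ⟨x, hx⟩ := hs (kerSingle j.1 ⟨_, hy'⟩)
  have hx : θ x = kerSingle j.1 ⟨_, hy'⟩ := congrArg Subtype.val hx
  have hfl : f l x = 1 := by
    rw [hf', hx, fiberProj_kerSingle_of_ne hne'.symm, map_one]
  have hfj : f j x = y := by
    rw [hf', hx, fiberProj_kerSingle_self]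
    exact (e j).apply_symm_apply _
  have h1 : ∀ m, i m = i l → f m x = 1 := by
    have hl : fiberProj η (i l) x = 1 := by
      have := (injective_iff_map_eq_one _).1 (hb l).1 (kerProj (i l) x)
        (Subtype.ext ((hcf l x).trans hfl))
      exact congrArg Subtype.val this
    intro m hm
    rw [← hcf]
    have : fiberProj η (i m) x = 1 := by rw [hm]; exact hl
    rw [this, map_one]
  exact hy (Subtype.ext (hfj.symm.trans (h1 j hijl)))

end ProfiniteCover

/-! ### Sufficiency: independence of components -/

namespace ProfiniteCover

variable {G G' A : Type u} [Group G] [TopologicalSpace G] [Group G'] [TopologicalSpace G']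
  [AddCommGroup A]

section CommonKer

variable {I' : Type u} {η' : I' → ProfiniteCover G'} {π : G →ₜ* G'} {p : ProfiniteCover G}

/-- The intersection of the kernels of a cover and of finitely many homomorphisms. -/
def commonKer (f : ∀ j, p.E →ₜ* (η' j).E) (s : Finset I') : Subgroup p.E where
  carrier := {x | p.map x = 1 ∧ ∀ l ∈ s, f l x = 1}
  mul_mem' := fun ⟨h1, h2⟩ ⟨k1, k2⟩ =>
    ⟨by rw [map_mul, h1, k1, mul_one], fun l hl => by rw [map_mul, h2 l hl, k2 l hl, mul_one]⟩
  one_mem' := ⟨map_one _, fun l _ => map_one _⟩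
  inv_mem' := fun ⟨h1, h2⟩ =>
    ⟨by rw [map_inv, h1, inv_one], fun l hl => by rw [map_inv, h2 l hl, inv_one]⟩

instance (f : ∀ j, p.E →ₜ* (η' j).E) (s : Finset I') : (commonKer f s).Normal :=
  ⟨fun x ⟨h1, h2⟩ y => ⟨by simp [h1], fun l hl => by simp [h2 l hl]⟩⟩

theorem isClosed_commonKer [T2Space G] (f : ∀ j, p.E →ₜ* (η' j).E) (s : Finset I') :
    IsClosed (commonKer f s : Set p.E) := by
  have : (commonKer f s : Set p.E) = {x | p.map x = 1} ∩ ⋂ l ∈ s, {x | f l x = 1} := by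
    ext x
    simp [commonKer]
  rw [this]
  exact p.isClosed_ker.inter (isClosed_biInter fun l _ =>
    isClosed_eq (f l).continuous_toFun continuous_const)

/-- Goursat's lemma for equivariant homomorphisms: one that is trivial on the common kernel of
finitely many homomorphisms to indecomposable covers is a sum of homomorphisms that factor through
these. -/
theorem exists_eq_sum_of_commonKer [T2Space G] [T2Space G']
    (hη' : ∀ j, (η' j).IsIndecomposable) (f : ∀ j, p.E →ₜ* (η' j).E)
    (hf : ∀ j x, (η' j).map (f j x) = π (p.map x)) (hs : ∀ j, Function.Surjective (f j))
    {ρ' : G' →* AddMonoid.End A} (s : Finset I') (ψ : p.kerDual (inflModule π ρ'))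
    (h : ∀ x : p.ker, (x : p.E) ∈ commonKer f s → ψ.1 x = 0) :
    ∃ g : ∀ j, (η' j).kerDual ρ', ∀ x, ψ.1 x = ∑ l ∈ s, (g l).1 (kerMap (f l) (hf l) x) := by
  classical
  induction s using Finset.induction_on generalizing ψ with
  | empty =>
    refine ⟨fun _ => 0, fun x => ?_⟩
    rw [Finset.sum_empty]
    exact h x ⟨x.2, fun l hl => absurd hl (Finset.notMem_empty l)⟩
  | insert a s ha ih =>
    obtain ⟨γ, hγ⟩ : ∃ γ : (η' a).kerDual ρ', ∀ x : p.ker, (x : p.E) ∈ commonKer f s →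
        ψ.1 x = γ.1 (kerMap (f a) (hf a) x) := by
      have hmem : ∀ x, x ∈ commonKer f s → f a x = 1 → x ∈ commonKer f (insert a s) :=
        fun x hx hx' => ⟨hx.1, fun l hl => by
          rcases Finset.mem_insert.1 hl with rfl | hl
          exacts [hx', hx.2 l hl]⟩
      rcases (hη' a).eq_one_or_exists (f a) (hs a) (commonKer f s) (isClosed_commonKer f s)
        (fun x hx => by rw [mem_ker, hf, hx.1, map_one]) with h1 | h1
      · exact ⟨0, fun x hx => h x (hmem x hx (h1 x hx))⟩
      -- Here `f a` maps the common kernel of `s` onto the kernel of `η' a`, and there `ψ` depends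
      -- only on `f a`. It descends to `γ`; subtracting the pullback of `γ` reduces to `s`.
      · choose m hm hfm using fun y : (η' a).ker => h1 y y.2
        have hwd : ∀ x y : p.ker, (x : p.E) ∈ commonKer f s → (y : p.E) ∈ commonKer f s →
            f a x = f a y → ψ.1 x = ψ.1 y := fun x y hx hy hxy => by
          have := h (x⁻¹ * y) (hmem _ (mul_mem (inv_mem hx) hy) (by
            change f a ((x : p.E)⁻¹ * y) = 1
            rw [map_mul, map_inv, hxy, inv_mul_cancel]))
          rw [kerDual_map_mul, kerDual_map_inv, neg_add_eq_zero] at this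
          exact this
        have := (hη' a).discreteTopology_ker
        refine ⟨⟨fun y => ψ.1 ⟨m y, (hm y).1⟩, IsLocallyConstant.of_discrete _, fun y z => ?_,
          fun w y => ?_⟩, fun x hx => hwd _ _ hx (hm _) (hfm (kerMap (f a) (hf a) x)).symm⟩
        · rw [← kerDual_map_mul]
          refine hwd _ _ (hm _) (mul_mem (hm y) (hm z)) ?_
          change f a (m (y * z)) = f a (m y * m z)
          rw [map_mul, hfm, hfm, hfm]
          rfl
        · obtain ⟨x, rfl⟩ := hs a w
          change _ = ρ' _ (ψ.1 ⟨m y, (hm y).1⟩)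
          rw [hf]
          refine Eq.trans ?_ (kerDual_map_conj ψ x _)
          refine hwd _ _ (hm _) ((inferInstance : (commonKer f s).Normal).conj_mem _ (hm y) x) ?_
          change f a (m _) = f a (x * m y * x⁻¹)
          rw [map_mul, map_mul, map_inv, hfm, hfm]
    obtain ⟨g, hg⟩ := ih (ψ - pullDual (f a) (hf a) (inflModule π ρ') (fun _ => rfl) γ)
      fun x hx => sub_eq_zero.2 (hγ x hx)
    refine ⟨Function.update g a γ, fun x => ?_⟩
    rw [Finset.sum_insert ha, Function.update_self]
    have h1 : ψ.1 x - γ.1 (kerMap (f a) (hf a) x) = _ := hg x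
    rw [sub_eq_iff_eq_add'.1 h1]
    congr 1
    refine Finset.sum_congr rfl fun l hl => ?_
    rw [Function.update_of_ne (by rintro rfl; exact ha hl)]

variable [IsTopologicalGroup G] [CompactSpace G] [TotallyDisconnectedSpace G]
  [IsTopologicalGroup G'] [CompactSpace G'] [TotallyDisconnectedSpace G']

omit [CompactSpace G] in
/-- A homomorphism to a fiber product of indecomposable covers maps onto its kernel if the
components are surjective and independent. -/
theorem kerMap_fiberLift_surjective (hη' : ∀ j, (η' j).IsIndecomposable)
    (f : ∀ j, p.E →ₜ* (η' j).E) (hf : ∀ j x, (η' j).map (f j x) = π (p.map x))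
    (hs : ∀ j, Function.Surjective (f j))
    (hind : ∀ (s : Finset I') (j : I'), j ∉ s → ∃ x ∈ commonKer f s, f j x ≠ 1) :
    Function.Surjective (kerMap (p := p) (q := fiberProduct η') (π := π)
      (fiberLift (π.comp p.map) f hf) fun _ => rfl) := by
  classical
  intro y
  have hfin : ∀ s : Finset I', ∃ x ∈ p.ker, ∀ l ∈ s, f l x = fiberProj η' l y := by
    intro s
    induction s using Finset.induction_on with
    | empty => exact ⟨1, p.ker.one_mem, by simp⟩
    | insert a s ha ih =>
      obtain ⟨x, hx, hxs⟩ := ih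
      obtain ⟨z, hz, hz1⟩ := hind s a ha
      -- Independence and minimality make `f a` map the common kernel of `s` onto the kernel of `η'
      -- a`, so the `a`-component can be corrected without disturbing those in `s`.
      have h1 := ((hη' a).eq_one_or_exists (f a) (hs a) (commonKer f s) (isClosed_commonKer f s)
        (fun x hx => by rw [mem_ker, hf, hx.1, map_one])).resolve_left fun h => hz1 (h z hz)
      obtain ⟨w, hw, hwa⟩ := h1 ((f a x)⁻¹ * fiberProj η' a y) (by
        rw [mem_ker, map_mul, map_inv, hf, mem_ker.1 hx, map_fiberProj, mem_ker.1 y.2]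
        simp)
      refine ⟨x * w, mul_mem hx hw.1, fun l hl => ?_⟩
      rcases Finset.mem_insert.1 hl with rfl | hl
      · rw [map_mul, hwa, mul_inv_cancel_left]
      · rw [map_mul, hw.2 l hl, mul_one, hxs l hl]
  obtain ⟨x, hx, hxy⟩ := p.isClosed_ker.isCompact.inter_iInter_nonempty
    (fun l => {x | f l x = fiberProj η' l y})
    (fun l => isClosed_eq (f l).continuous_toFun continuous_const) fun s => by
      obtain ⟨x, hx, h⟩ := hfin s
      exact ⟨x, hx, by simpa using h⟩
  rw [Set.mem_iInter] at hxy
  refine ⟨⟨x, hx⟩, Subtype.ext (fiberProduct_ext ?_ hxy)⟩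
  change π (p.map x) = _
  rw [mem_ker.1 hx, map_one, mem_ker.1 y.2]

end CommonKer

theorem Iso.symm {p q : ProfiniteCover G} (h : p.Iso q) : q.Iso p := by
  obtain ⟨e, he⟩ := h
  exact ⟨e.symm, fun x => by rw [← he, ContinuousMulEquiv.apply_symm_apply]⟩

theorem Iso.trans {p q r : ProfiniteCover G} (h : p.Iso q) (h' : q.Iso r) : p.Iso r := by
  obtain ⟨e, he⟩ := h
  obtain ⟨e', he'⟩ := h'
  exact ⟨e.trans e', fun x => (he' _).trans (he x)⟩

theorem Iso.refl (p : ProfiniteCover G) : p.Iso p := ⟨ContinuousMulEquiv.refl _, fun _ => rfl⟩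

theorem HasNonabelianKernel.of_kerMap {π : G →ₜ* G'} {p : ProfiniteCover G}
    {q : ProfiniteCover G'} (c : p.E →ₜ* q.E) (hc : ∀ x, q.map (c x) = π (p.map x))
    (hs : Function.Surjective (kerMap c hc)) (h : q.HasNonabelianKernel) :
    p.HasNonabelianKernel := by
  obtain ⟨x, hx, y, hy, hxy⟩ := h
  obtain ⟨a, ha⟩ := hs ⟨x, hx⟩
  obtain ⟨b, hb⟩ := hs ⟨y, hy⟩
  have ha : c a = x := congrArg Subtype.val ha
  have hb : c b = y := congrArg Subtype.val hb
  refine ⟨a, a.2, b, b.2, fun h => hxy ?_⟩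
  rw [← ha, ← hb, ← map_mul, h, map_mul]

/-! ### Sufficiency: matching the non-abelian kernels -/

section Nonabelian

variable [IsTopologicalGroup G] [CompactSpace G] [TotallyDisconnectedSpace G]
  [IsTopologicalGroup G'] [CompactSpace G'] [TotallyDisconnectedSpace G']
  {π : G →ₜ* G'} {p : ProfiniteCover G}

omit [CompactSpace G] in
/-- A minimal non-abelian kernel has trivial centre. -/
theorem IsIndecomposable.eq_one_of_commute {q : ProfiniteCover G} (hq : q.IsIndecomposable)
    (hqn : q.HasNonabelianKernel) (z : q.E) (hz : z ∈ q.ker) (h : ∀ y ∈ q.ker, z * y = y * z) :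
    z = 1 := by
  let N : Subgroup q.E := q.ker ⊓ Subgroup.centralizer (q.ker : Set q.E)
  have hcl : IsClosed (N : Set q.E) := by
    have := hq.finite_ker
    exact ((Set.toFinite (q.ker : Set q.E)).subset fun x hx => hx.1).isClosed
  have hN : N.Normal := Subgroup.normal_inf_normal _ _
  have hzN : z ∈ N := ⟨hz, fun y hy => (h y hy).symm⟩
  rcases hq.eq_bot_or_eq_ker N hcl inf_le_left with h1 | h1
  · rwa [h1] at hzN
  · obtain ⟨x, hx, y, hy, hxy⟩ := hqn
    rw [← h1] at hx
    exact absurd (hx.2 y hy).symm hxy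

-- If `c x = 1`, then `x` centralizes `p.ker`, because `c` is injective there. Hence `d x` is
-- central in `r.ker` and so trivial. By symmetry `c` and `d` have the same kernel, so a cover with
-- non-abelian kernel is the inflation of at most one such cover up to isomorphism.
omit [IsTopologicalGroup G] [CompactSpace G] [TotallyDisconnectedSpace G] [CompactSpace G'] in
theorem iso_of_kerMap_bijective (hπ : Function.Surjective π) {q r : ProfiniteCover G'}
    (hq : q.IsIndecomposable) (hqn : q.HasNonabelianKernel)
    (hr : r.IsIndecomposable) (hrn : r.HasNonabelianKernel)
    (c : p.E →ₜ* q.E) (hc : ∀ x, q.map (c x) = π (p.map x)) (hb : Function.Bijective (kerMap c hc))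
    (d : p.E →ₜ* r.E) (hd : ∀ x, r.map (d x) = π (p.map x))
    (hb' : Function.Bijective (kerMap d hd)) : q.Iso r := by
  have aux : ∀ {q r : ProfiniteCover G'} (_ : r.IsIndecomposable) (_ : r.HasNonabelianKernel)
      (c : p.E →ₜ* q.E) (hc : ∀ x, q.map (c x) = π (p.map x))
      (_ : Function.Bijective (kerMap c hc))
      (d : p.E →ₜ* r.E) (hd : ∀ x, r.map (d x) = π (p.map x))
      (_ : Function.Bijective (kerMap d hd)) (x), c x = 1 → d x = 1 := by
    intro q r hr hrn c hc hb d hd hb' x hx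
    refine hr.eq_one_of_commute hrn _ ?_ fun y hy => ?_
    · rw [mem_ker, hd, ← hc, hx, map_one]
    · obtain ⟨k, hk⟩ := hb'.2 ⟨y, hy⟩
      have hk : d k = y := congrArg Subtype.val hk
      have hxk : (⟨x * k * x⁻¹, p.conj_mem_ker x k⟩ : p.ker) = k := hb.1 (Subtype.ext (by
        change c (x * k * x⁻¹) = c k
        simp [hx]))
      have hxk : x * k * x⁻¹ = k := congrArg Subtype.val hxk
      rw [← hk, ← map_mul, ← map_mul, mul_inv_eq_iff_eq_mul.1 hxk]
  have hcs := surjective_of_kerMap hπ c hc hb.2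
  have hds := surjective_of_kerMap hπ d hd hb'.2
  obtain ⟨e, he⟩ := exists_comp_eq c hcs d (aux hr hrn c hc hb d hd hb')
  refine iso_of_bijective e (fun y => ?_)
    ⟨(injective_iff_map_eq_one e).2 fun y hy => ?_, fun z => ?_⟩
  · obtain ⟨x, rfl⟩ := hcs y
    rw [he, hd, hc]
  · obtain ⟨x, rfl⟩ := hcs y
    rw [he] at hy
    exact aux hq hqn d hd hb' c hc hb x hy
  · obtain ⟨x, rfl⟩ := hds z
    exact ⟨c x, he x⟩

omit [CompactSpace G'] in
theorem Iso.exists_kerMap_bijective {q : ProfiniteCover G'} (h : p.Iso (infl π q)) :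
    ∃ (c : p.E →ₜ* q.E) (hc : ∀ x, q.map (c x) = π (p.map x)),
      Function.Bijective (kerMap c hc) := by
  obtain ⟨e, he⟩ := h
  let s : (infl π q).E →ₜ* q.E :=
    { toFun := fun x => x.1.2
      map_one' := rfl
      map_mul' := fun _ _ => rfl
      continuous_toFun := continuous_snd.comp continuous_subtype_val }
  have hs : ∀ y : (infl π q).E, q.map (s y) = π ((infl π q).map y) := fun y => y.2
  refine ⟨s.comp (e : p.E →ₜ* (infl π q).E), fun x => ?_, ?_, ?_⟩
  · rw [← he]
    exact hs _
  · refine (injective_iff_map_eq_one _).2 fun k hk => Subtype.ext (e.injective ?_)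
    rw [OneMemClass.coe_one, map_one]
    have h1 : (infl π q).map (e k) = 1 := (he k).trans k.2
    exact Subtype.ext (Prod.ext h1 (congrArg Subtype.val hk))
  · intro y
    let z : (infl π q).E := ⟨(1, y), by
      change q.map y = π 1
      rw [mem_ker.1 y.2, map_one]⟩
    refine ⟨⟨e.symm z, ?_⟩, Subtype.ext ?_⟩
    · rw [mem_ker, ← he, ContinuousMulEquiv.apply_symm_apply]; rfl
    · change s (e (e.symm z)) = y
      rw [ContinuousMulEquiv.apply_symm_apply]
      rfl

omit [CompactSpace G'] in
/-- The cardinality condition on non-abelian kernels yields a simultaneous matching of the covers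
with non-abelian kernel. -/
theorem exists_matching (hπ : Function.Surjective π) {I I' : Type u} {η : I → ProfiniteCover G}
    {η' : I' → ProfiniteCover G'} (hη' : ∀ j, (η' j).IsIndecomposable)
    (h : ∀ ζ' : ProfiniteCover G', ζ'.IsIndecomposable → ζ'.HasNonabelianKernel →
      Cardinal.mk {i : I' // (η' i).Iso ζ'} ≤ Cardinal.mk {i : I // (η i).Iso (infl π ζ')}) :
    ∃ ι : {j // (η' j).HasNonabelianKernel} → I, Function.Injective ι ∧
      ∀ j, ∃ (c : (η (ι j)).E →ₜ* (η' j).E) (hc : ∀ x, (η' j).map (c x) = π ((η (ι j)).map x)),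
        Function.Bijective (kerMap c hc) := by
  let N := {j // (η' j).HasNonabelianKernel}
  let r : Setoid N := ⟨fun j l => (η' j).Iso (η' l), fun _ => Iso.refl _, Iso.symm, Iso.trans⟩
  let m : N → Quotient r := Quotient.mk r
  have hr : ∀ j : N, (η' j).Iso (η' (m j).out) := fun j => Iso.symm (Quotient.mk_out (s := r) j)
  -- The hypothesis gives one embedding for each isomorphism class. Different classes have disjoint
  -- images by `iso_of_kerMap_bijective`, so the embeddings combine into an injection.
  obtain ⟨F⟩ := Classical.nonempty_pi.2 fun k : Quotient r =>
    (Cardinal.le_def _ _).1 (h (η' k.out) (hη' _) k.out.2)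
  let ι : N → I := fun j => (F (m j) ⟨j, hr j⟩).1
  have hι : ∀ j, (η (ι j)).Iso (infl π (η' (m j).out)) := fun j =>
    (F (m j) ⟨j, hr j⟩).2
  choose c hc hb using fun j => (hι j).exists_kerMap_bijective
  refine ⟨ι, fun j l hjl => ?_, fun j => ?_⟩
  · have key : ∀ i i', i = i' →
        ∀ (c : (η i).E →ₜ* (η' (m j).out).E)
          (hc : ∀ x, _ = π ((η i).map x)) (_ : Function.Bijective (kerMap c hc))
          (d : (η i').E →ₜ* (η' (m l).out).E)
          (hd : ∀ x, _ = π ((η i').map x)) (_ : Function.Bijective (kerMap d hd)),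
        m j = m l := by
      rintro i _ rfl c hc hb d hd hb'
      have := iso_of_kerMap_bijective hπ (hη' _) (m j).out.2 (hη' _)
        (m l).out.2 c hc hb d hd hb'
      exact Quotient.out_equiv_out.1 this
    have hq := key _ _ hjl (c j) (hc j) (hb j) (c l) (hc l) (hb l)
    have key' : ∀ k k' : Quotient r, k = k' → ∀ a b, (F k a).1 = (F k' b).1 → a.1 = b.1 := by
      rintro k _ rfl a b hab
      exact congrArg Subtype.val ((F k).injective (Subtype.ext hab))
    exact Subtype.ext (key' _ _ hq _ _ hjl)
  · obtain ⟨e, he⟩ := (hr j).symm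
    refine ⟨(e : (η' (m j).out).E →ₜ* (η' j).E).comp (c j), fun x => (he _).trans (hc j x), ?_, ?_⟩
    · refine (injective_iff_map_eq_one _).2 fun k hk => ?_
      refine (injective_iff_map_eq_one _).1 (hb j).1 k (Subtype.ext (e.injective ?_))
      exact (congrArg Subtype.val hk).trans (map_one e).symm
    · intro y
      obtain ⟨k, hk⟩ := (hb j).2 ⟨e.symm y, by
        rw [mem_ker, ← he, ContinuousMulEquiv.apply_symm_apply]; exact y.2⟩
      refine ⟨k, Subtype.ext ?_⟩
      change e (c j k) = y
      rw [(show c j k = e.symm y from congrArg Subtype.val hk),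
        ContinuousMulEquiv.apply_symm_apply]

end Nonabelian

end ProfiniteCover

/-! ### Sufficiency: abelian kernels and construction of θ -/

/-- A finite simple `G`-module, bundled. -/
structure FiniteSimpleModule (G : Type u) [Group G] [TopologicalSpace G] where
  /-- the underlying group -/
  A : Type u
  [addCommGroup : AddCommGroup A]
  /-- the action -/
  ρ : G →* AddMonoid.End A
  isSimple : IsFiniteSimpleModule ρ

namespace FiniteSimpleModule

attribute [instance] addCommGroup

end FiniteSimpleModule

namespace ProfiniteCover

variable {G G' A : Type u} [Group G] [TopologicalSpace G] [Group G'] [TopologicalSpace G']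
  [AddCommGroup A]

/-- Two covers that share one kernel module share all of them; this allows a single representative
to be chosen for each isotypic class. -/
theorem KernelIso.trans {B : Type u} [AddCommGroup B] {p q : ProfiniteCover G}
    {ρ : G →* AddMonoid.End A} {σ : G →* AddMonoid.End B} (hp : p.KernelIso ρ)
    (hq : q.KernelIso ρ) (hp' : p.KernelIso σ) : q.KernelIso σ := by
  obtain ⟨e, e1, e2⟩ := hp
  obtain ⟨f, f1, f2⟩ := hq
  obtain ⟨g, g1, g2⟩ := hp'
  have hmul : ∀ a b, e.symm (a + b) = e.symm a * e.symm b := fun a b =>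
    e.injective (by rw [e1]; simp)
  refine ⟨(f.trans e.symm).trans g, fun x y => ?_, fun h x => ?_⟩
  · change g (e.symm (f (x * y))) = g (e.symm (f x)) + g (e.symm (f y))
    rw [f1, hmul, g1]
  · obtain ⟨k, hk⟩ := p.surjective (q.map h)
    change g (e.symm (f _)) = σ _ (g (e.symm (f x)))
    rw [f2, ← hk, ← g2]
    congr 1
    apply e.injective
    rw [e2]
    simp

theorem kerDual_sum_apply {p : ProfiniteCover G} {ρ : G →* AddMonoid.End A} {J : Type u}
    (s : Finset J) (φ : J → p.kerDual ρ) (x : p.ker) :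
    (∑ l ∈ s, φ l).1 x = ∑ l ∈ s, (φ l).1 x := by
  rw [AddSubmonoidClass.coe_finsetSum, Finset.sum_apply]

variable [IsTopologicalGroup G] [CompactSpace G] [TotallyDisconnectedSpace G]
  [IsTopologicalGroup G'] [CompactSpace G'] [TotallyDisconnectedSpace G']
  {I I' : Type u} {η : I → ProfiniteCover G} {η' : I' → ProfiniteCover G'} {π : G →ₜ* G'}

/-- The extension of an equivariant homomorphism to the full fiber product. -/
def fullDual {ρ : G →* AddMonoid.End A} (φ : V η ρ) : (fiberProduct η).kerDual ρ :=
  pullDual (toIsotypic η ρ) (map_toIsotypic ρ) ρ (fun _ => rfl) φ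

/-- The equivariant homomorphism on the isotypic part given by one on a factor. -/
def isotypicDual {ρ : G →* AddMonoid.End A} {i : I} (h : (η i).KernelIso ρ)
    (φ : (η i).kerDual ρ) : V η ρ :=
  pullDual (π := ContinuousMonoidHom.id G) (p := isotypicFiberProduct η ρ)
    (fiberProj (fun i : {i : I // (η i).KernelIso ρ} => η i) ⟨i, h⟩)
    (fun x => map_fiberProj _ x) ρ (fun _ => rfl) φ

theorem S_isotypicDual {ρ : G →* AddMonoid.End A} {i : I} (h : (η i).KernelIso ρ)
    (φ : (η i).kerDual ρ) : S η ρ (isotypicDual h φ) = (η i).transgression ρ φ :=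
  transgression_pullDual _ _ ρ φ

theorem transgression_fullDual {ρ : G →* AddMonoid.End A} (φ : V η ρ) :
    (fiberProduct η).transgression ρ (fullDual φ) = S η ρ φ :=
  transgression_pullDual _ _ ρ φ

theorem fullDual_injective {ρ : G →* AddMonoid.End A} :
    Function.Injective (fullDual : V η ρ → (fiberProduct η).kerDual ρ) :=
  pullDual_injective _ _ _ (fun _ => rfl) (kerMap_toIsotypic_surjective ρ)

theorem isotypicDual_apply_kerSingle_self {ρ : G →* AddMonoid.End A} {i : I}
    (h : (η i).KernelIso ρ) (φ : (η i).kerDual ρ) (k : (η i).ker) :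
    (isotypicDual h φ).1 (kerSingle ⟨i, h⟩ k) = φ.1 k :=
  congrArg φ.1 (Subtype.ext (fiberProj_kerSingle_self
    (η := fun i : {i : I // (η i).KernelIso ρ} => η i) ⟨i, h⟩ k))

theorem isotypicDual_apply_kerSingle_of_ne {ρ : G →* AddMonoid.End A} {i l : I}
    (h : (η i).KernelIso ρ) (hl : (η l).KernelIso ρ) (hne : i ≠ l) (φ : (η i).kerDual ρ)
    (k : (η l).ker) : (isotypicDual h φ).1 (kerSingle ⟨l, hl⟩ k) = 0 := by
  rw [← kerDual_map_one φ]
  exact congrArg φ.1 (Subtype.ext (fiberProj_kerSingle_of_ne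
    (η := fun i : {i : I // (η i).KernelIso ρ} => η i) (i := ⟨l, hl⟩) (l := ⟨i, h⟩)
    (fun h => hne (congrArg Subtype.val h)) k))

/-- An injective semilinear map compatible with the maps `S` is induced, on each isotypic factor,
by an epimorphism over `π`. -/
theorem exists_hom_of_isotypic (hπ : Function.Surjective π) {ρ' : G' →* AddMonoid.End A}
    (hρ' : IsFiniteSimpleModule ρ') (T : V η' ρ' →+ V η (inflModule π ρ'))
    (hT : Function.Injective T) (hTsmul : ∀ (a : endRing ρ') v, T (a • v) = inflEnd π ρ' a • T v)
    (hTS : ∀ v, S η (inflModule π ρ') (T v) = (inflH2 π ρ').comp (S η' ρ') v) {j : I'}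
    (hj : (η' j).IsIndecomposable) (h : (η' j).KernelIso ρ') :
    ∃ (f : (fiberProduct η).E →ₜ* (η' j).E)
      (hf : ∀ x, (η' j).map (f x) = π ((fiberProduct η).map x)), Function.Surjective f ∧
        ∀ g k, g.1 (kerMap f hf k) = (fullDual (T (isotypicDual h g))).1 k := by
  obtain ⟨φ, hφ⟩ := h.exists_bijective hj
  obtain ⟨f, hf, hfφ⟩ := exists_hom_of_transgression_eq φ hφ (fullDual (T (isotypicDual h φ))) (by
    rw [transgression_fullDual, hTS, LinearMap.comp_apply, S_isotypicDual])
  refine ⟨f, hf, surjective_of_kerMap hπ f hf fun y => ?_, fun g k => ?_⟩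
  · have hne : fullDual (T (isotypicDual h φ)) ≠ 0 := by
      intro h0
      have h1 : T (isotypicDual h φ) = 0 := fullDual_injective h0
      rw [map_eq_zero_iff T hT] at h1
      obtain ⟨y, hy⟩ := hj.exists_ne_one
      refine hy (hφ.1 ?_)
      rw [← isotypicDual_apply_kerSingle_self h φ y, h1, kerDual_map_one]
      rfl
    obtain ⟨k, hk⟩ := kerDual_surjective (hρ'.infl hπ) _ hne (φ.1 y)
    exact ⟨k, hφ.1 ((hfφ k).trans hk)⟩
  · let e := Equiv.ofBijective φ.1 hφ
    have he : ∀ a, φ.1 (e.symm a) = a := e.apply_symm_apply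
    -- As `φ` is bijective, every `g` is `α ∘ φ` for an equivariant endomorphism `α`. Semilinearity
    -- of `T` then carries the formula from `φ` to `g`.
    let α : endRing ρ' := ⟨AddMonoidHom.mk' (fun a => g.1 (e.symm a)) fun a b => by
      rw [← kerDual_map_mul]
      refine congrArg g.1 (hφ.1 ?_)
      rw [kerDual_map_mul, he, he, he], fun x a => by
      obtain ⟨x, rfl⟩ := (η' j).surjective x
      change g.1 (e.symm _) = ρ' _ (g.1 (e.symm a))
      rw [← kerDual_map_conj]
      refine congrArg g.1 (hφ.1 ?_)
      rw [kerDual_map_conj, he, he]⟩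
    have hα : ∀ y, α.1 (φ.1 y) = g.1 y := fun y => congrArg g.1 (e.symm_apply_apply y)
    have hgα : isotypicDual h g = α • isotypicDual h φ :=
      Subtype.ext (funext fun y => (hα _).symm)
    rw [hgα, hTsmul, ← hα, hfφ]
    rfl

/-- The components of θ are prescribed one by one: through the matched factor for a non-abelian
kernel, through `T` for an abelian one. Only their independence needs proof. -/
theorem exists_epimorphism (hπ : Function.Surjective π) (hη : ∀ i, (η i).IsIndecomposable)
    (hη' : ∀ j, (η' j).IsIndecomposable)
    (ha : ∀ ζ' : ProfiniteCover G', ζ'.IsIndecomposable → ζ'.HasNonabelianKernel →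
      Cardinal.mk {i : I' // (η' i).Iso ζ'} ≤ Cardinal.mk {i : I // (η i).Iso (infl π ζ')})
    (hb : ∀ (A' : Type u) [AddCommGroup A'] (ρ' : G' →* AddMonoid.End A'),
      IsFiniteSimpleModule ρ' →
      Set.range ((inflH2 π ρ').comp (S η' ρ')) ⊆ Set.range (S η (inflModule π ρ')) ∧
      Module.rank (endRing ρ') (LinearMap.ker ((inflH2 π ρ').comp (S η' ρ'))) ≤
        Module.rank (endRing (inflModule π ρ')) (LinearMap.ker (S η (inflModule π ρ')))) :
    ∃ (θ : (fiberProduct η).E →ₜ* (fiberProduct η').E)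
      (hθ : ∀ x, (fiberProduct η').map (θ x) = π ((fiberProduct η).map x)),
      Function.Surjective (kerMap θ hθ) := by
  classical
  obtain ⟨ι, hι, hιc⟩ := exists_matching hπ hη' ha
  choose c hc hcb using hιc
  choose T hT hTsmul hTS using fun M : FiniteSimpleModule G' =>
    have := M.isSimple.nontrivial_endRing
    exists_injective_comp_eq M.isSimple.isUnit_or_eq_zero (inflEnd_bijective hπ M.ρ)
      ((inflH2 π M.ρ).comp (S η' M.ρ)) (S η (inflModule π M.ρ)) (hb M.A M.ρ M.isSimple).1
      (hb M.A M.ρ M.isSimple).2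
  -- The representative is chosen from the set `C j`, not from `j`. Covers with isomorphic kernels
  -- then get equal modules, and so the same `T`.
  let C : I' → Set (FiniteSimpleModule G') := fun j => {M | (η' j).KernelIso M.ρ}
  have hC : ∀ {j}, ¬ (η' j).HasNonabelianKernel → (C j).Nonempty := fun {j} h => by
    obtain ⟨A, _, ρ, h1, h2⟩ := (hη' j).exists_kernelIso h
    exact ⟨⟨A, ρ, h1⟩, h2⟩
  let rep : ∀ j, ¬ (η' j).HasNonabelianKernel → FiniteSimpleModule G' := fun j h => (hC h).some
  have hrep : ∀ j h, (η' j).KernelIso (rep j h).ρ := fun j h => (hC h).some_mem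
  have hrep_eq : ∀ j h l h', (η' l).KernelIso (rep j h).ρ → rep l h' = rep j h := by
    intro j h l h' hl
    have hCC : C l = C j := Set.ext fun M =>
      ⟨fun hM => hl.trans (hrep j h) hM, fun hM => (hrep j h).trans hl hM⟩
    have : ∀ (X Y : Set (FiniteSimpleModule G')) (hX : X.Nonempty) (hY : Y.Nonempty), X = Y →
        hX.some = hY.some := by
      rintro X _ _ _ rfl
      rfl
    exact this _ _ _ _ hCC
  have hfam : ∀ j, ∃ (f : (fiberProduct η).E →ₜ* (η' j).E)
      (hf : ∀ x, (η' j).map (f x) = π ((fiberProduct η).map x)), Function.Surjective f ∧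
      (∀ h : (η' j).HasNonabelianKernel, ∀ x, f x = c ⟨j, h⟩ (fiberProj η (ι ⟨j, h⟩) x)) ∧
      ∀ (h : ¬ (η' j).HasNonabelianKernel) (g) (k), g.1 (kerMap f hf k) =
        (fullDual (T (rep j h) (isotypicDual (hrep j h) g))).1 k := by
    intro j
    by_cases h : (η' j).HasNonabelianKernel
    · refine ⟨(c ⟨j, h⟩).comp (fiberProj η (ι ⟨j, h⟩)), fun x => ?_, ?_, fun _ _ => rfl,
        fun h' => absurd h h'⟩
      · exact (hc ⟨j, h⟩ _).trans (congrArg π (map_fiberProj _ x))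
      · exact (surjective_of_kerMap hπ (c ⟨j, h⟩) (hc ⟨j, h⟩) (hcb ⟨j, h⟩).2).comp
          (fiberProj_surjective _)
    · obtain ⟨f, hf, hfs, hfg⟩ := exists_hom_of_isotypic hπ (rep j h).isSimple (T (rep j h))
        (hT _) (hTsmul _) (hTS _) (hη' j) (hrep j h)
      exact ⟨f, hf, hfs, fun h' => absurd h' h, fun _ => hfg⟩
  choose f hf hfs hfn hfa using hfam
  refine ⟨_, _, kerMap_fiberLift_surjective hη' f hf hfs fun s j hjs => ?_⟩
  by_cases h : (η' j).HasNonabelianKernel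
  · obtain ⟨y, hy⟩ := (hη' j).exists_ne_one
    obtain ⟨k, hk⟩ := (hcb ⟨j, h⟩).2 y
    -- An element of the matched factor alone is invisible to the other components: the non-abelian
    -- ones use other factors, and an equivariant map from a non-abelian minimal kernel to a simple
    -- module is zero.
    refine ⟨kerSingle (ι ⟨j, h⟩) k, ⟨(kerSingle (ι ⟨j, h⟩) k).2, fun l hl => ?_⟩, ?_⟩
    · by_cases hl' : (η' l).HasNonabelianKernel
      · rw [hfn l hl', fiberProj_kerSingle_of_ne, map_one]
        rintro heq
        obtain rfl : l = j := congrArg Subtype.val (hι heq)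
        exact hjs hl
      · obtain ⟨φ, hφ⟩ := (hrep l hl').exists_bijective (hη' l)
        have h1 := hfa l hl' φ (kerSingle (ι ⟨j, h⟩) k)
        have h2 : kerMap (f l) (hf l) (kerSingle (ι ⟨j, h⟩) k) = 1 := by
          apply hφ.1
          rw [h1, kerDual_map_one]
          rcases (hη (ι ⟨j, h⟩)).eq_zero_or_bijective ((rep l hl').isSimple.infl hπ)
            (singleDual (hη _) (fullDual (T (rep l hl') (isotypicDual (hrep l hl') φ))))
            with h3 | h3
          · exact congrFun (congrArg Subtype.val h3) k
          · exact absurd (HasNonabelianKernel.of_kerMap _ _ (hcb ⟨j, h⟩).2 h)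
              (kernelIso_of_bijective _ h3).not_hasNonabelianKernel
        exact congrArg Subtype.val h2
    · rw [hfn j h, fiberProj_kerSingle_self]
      intro h1
      rw [← hk] at hy
      exact hy (Subtype.ext h1)
  · by_contra hcon
    push Not at hcon
    obtain ⟨φ, hφ⟩ := (hrep j h).exists_bijective (hη' j)
    -- If component `j` were trivial on the common kernel, the pullback of its coordinate `φ` would
    -- be a sum of pullbacks along `s`. Only the `l` of the same isotypic class contribute, and
    -- injectivity of `T` turns this into a relation between coordinates on the isotypic product
    -- over `G'`; the factor `j ∉ s` refutes it.
    obtain ⟨g, hg⟩ := exists_eq_sum_of_commonKer hη' f hf hfs s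
      (fullDual (T (rep j h) (isotypicDual (hrep j h) φ))) fun x hx => by
        rw [← hfa j h, ← kerDual_map_one φ]
        exact congrArg φ.1 (Subtype.ext (hcon x hx))
    let γ : I' → V η' (rep j h).ρ := fun l =>
      if hl : (η' l).KernelIso (rep j h).ρ then isotypicDual hl (g l) else 0
    have hγ : ∀ l k, (g l).1 (kerMap (f l) (hf l) k) = (fullDual (T (rep j h) (γ l))).1 k := by
      intro l k
      by_cases hl : (η' l).KernelIso (rep j h).ρ
      · have hl' := hl.not_hasNonabelianKernel
        -- The module is made a variable so that the equality `rep l = rep j` can be substituted in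
        -- the dependent types.
        have key : ∀ (M : FiniteSimpleModule G') (_ : rep l hl' = M) (hM : (η' l).KernelIso M.ρ)
            (g : (η' l).kerDual M.ρ), g.1 (kerMap (f l) (hf l) k) =
              (fullDual (T M (isotypicDual hM g))).1 k := by
          rintro _ rfl hM g
          exact hfa l hl' g k
        simp only [γ, dif_pos hl]
        exact key _ (hrep_eq j h l hl' hl) hl (g l)
      · have hgl : g l = 0 :=
          ((hη' l).eq_zero_or_bijective (rep j h).isSimple (g l)).resolve_right fun h' =>
            hl (kernelIso_of_bijective _ h')
        simp only [γ, dif_neg hl, hgl, map_zero]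
        rfl
    have hsum : isotypicDual (hrep j h) φ = ∑ l ∈ s, γ l := by
      apply hT (rep j h)
      apply fullDual_injective
      refine Subtype.ext (funext fun k => ?_)
      rw [hg, map_sum]
      simp only [hγ]
      change _ = (∑ l ∈ s, T (rep j h) (γ l)).1 (kerMap (toIsotypic η _) (map_toIsotypic _) k)
      rw [kerDual_sum_apply]
      rfl
    obtain ⟨y, hy⟩ := (hη' j).exists_ne_one
    refine hy (hφ.1 ?_)
    rw [← isotypicDual_apply_kerSingle_self (hrep j h) φ y, hsum, kerDual_map_one]
    refine (kerDual_sum_apply s γ _).trans (Finset.sum_eq_zero fun l hl => ?_)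
    by_cases hl' : (η' l).KernelIso (rep j h).ρ
    · simp only [γ, dif_pos hl']
      exact isotypicDual_apply_kerSingle_of_ne _ _ (by rintro rfl; exact hjs hl) _ _
    · simp only [γ, dif_neg hl']
      rfl

end ProfiniteCover

/-! ### The theorem -/

theorem mainTheorem3 {G G' : Type u}
    [Group G] [TopologicalSpace G] [IsTopologicalGroup G] [CompactSpace G]
    [TotallyDisconnectedSpace G]
    [Group G'] [TopologicalSpace G'] [IsTopologicalGroup G'] [CompactSpace G']
    [TotallyDisconnectedSpace G']
    (π : G →ₜ* G') (hπ : Function.Surjective π)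
    {I I' : Type u} (η : I → ProfiniteCover G) (hη : ∀ i, (η i).IsIndecomposable)
    (η' : I' → ProfiniteCover G') (hη' : ∀ i, (η' i).IsIndecomposable) :
    (∃ θ : (ProfiniteCover.fiberProduct η).E →ₜ* (ProfiniteCover.fiberProduct η').E,
      Function.Surjective θ ∧
      IsSemiCartesian π (ProfiniteCover.fiberProduct η) (ProfiniteCover.fiberProduct η') θ) ↔
    (∀ ζ' : ProfiniteCover G', ζ'.IsIndecomposable → ζ'.HasNonabelianKernel →
      Cardinal.mk {i : I' // (η' i).Iso ζ'} ≤
        Cardinal.mk {i : I // (η i).Iso (ProfiniteCover.infl π ζ')}) ∧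
    (∀ (A' : Type u) [AddCommGroup A'] (ρ' : G' →* AddMonoid.End A'),
      IsFiniteSimpleModule ρ' →
      Set.range ((inflH2 π ρ').comp (ProfiniteCover.S η' ρ')) ⊆
        Set.range (ProfiniteCover.S η (inflModule π ρ')) ∧
      Module.rank (endRing ρ')
          (LinearMap.ker ((inflH2 π ρ').comp (ProfiniteCover.S η' ρ'))) ≤
        Module.rank (endRing (inflModule π ρ'))
          (LinearMap.ker (ProfiniteCover.S η (inflModule π ρ')))) := by
  constructor
  · rintro ⟨θ, -, h⟩
    obtain ⟨hθ, hs⟩ := (ProfiniteCover.isSemiCartesian_iff θ).1 h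
    exact ⟨fun ζ' hζ hζn => ProfiniteCover.mk_iso_le hπ hη θ hθ hs hζ hζn,
      fun A' _ ρ' hρ' => ProfiniteCover.range_subset_and_rank_le hπ hη θ hθ hs hρ'⟩
  · rintro ⟨ha, hb⟩
    obtain ⟨θ, hθ, hs⟩ := ProfiniteCover.exists_epimorphism hπ hη hη' ha hb
    exact ⟨θ, ProfiniteCover.surjective_of_kerMap hπ θ hθ hs,
      (ProfiniteCover.isSemiCartesian_iff θ).2 ⟨hθ, hs⟩⟩
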